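/- **Theorem 2.4.** Let $X,A,B,Y$ be finite outcome sets and let $p(x,a,b,y)$ be a *correlation* in the path scenario $P_4$ (parties $\mathtt X-\mathtt A-\mathtt B-\mathtt Y$, one source on each edge), i.e. a probability distribution on $X\times A\times B\times Y$ whose marginals satisfy $$p(x,a,y)=p(x,a)\,p(y),\qquad p(x,b,y)=p(x)\,p(b,y).$$ Assume $p(x)>0$ for all $x\in X$ and $p(y)>0$ for all $y\in Y$, and put $p(a,b|x,y)=p(x,a,b,y)/p(x,y)$. Then: 1. $p$ is classical in $P_4$ if and only if $p(a,b|x,y)$ is classical (local) in the bipartite Bell scenario with settings $x,y$ and outcomes $a,b$. 2. $p$ is quantum in $P_4$ if and only if $p(a,b|x,y)$ is quantum in that Bell scenario. Here the following definitions are used. A conditional distribution $p(o|\lambda)$ of a finite-valued outcome $o$ given a random variable $\lambda$ with values in a probability space consists of nonnegative measurable functions of $\lambda$, one for each value of $o$, with sum $1$ (all up to null sets). * $p$ is *classical in $P_4$* if there are probability spaces $(\Omega_{XA},P_{XA})$, $(\Omega_{AB},P_{AB})$, $(\Omega_{BY},P_{BY})$ and conditional distributions such that $$p(x,a,b,y)=\int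 p(x|\lambda_{XA})\,p(a|\lambda_{XA},\lambda_{AB})\,p(b|\lambda_{AB},\lambda_{BY})\,p(y|\lambda_{BY})\;d(P_{XA}\otimes P_{AB}\otimes P_{BY}).$$ * $p(a,b|x,y)$ is *classical in the Bell scenario* if there are a probability space $(\Omega,P)$ and conditional distributions $p(a|x,\lambda)$ and $p(b|y,\lambda)$ (for every $x$ and $y$) such that $p(a,b|x,y)=\int p(a|x,\lambda)\,p(b|y,\lambda)\,dP(\lambda)$. * $p$ is *quantum in $P_4$* if there are complex Hilbert spaces $H_{XA},H_{AX},H_{AB},H_{BA},H_{BY},H_{YB}$ of arbitrary dimension, states (positive trace-class operators of trace $1$) $\rho_{XA}$ on $H_{XA}\otimes H_{AX}$, $\rho_{AB}$ on $H_{AB}\otimes H_{BA}$ and $\rho_{BY}$ on $H_{BY}\otimes H_{YB}$, and POVMs $(E_x)$ on $H_{XA}$, $(E_a)$ on $H_{AX}\otimes H_{AB}$, $(E_b)$ on $H_{BA}\otimes H_{BY}$ and $(E_y)$ on $H_{YB}$ such that, after matching the tensor factors, $$p(x,a,b,y)=\operatorname{tr}\big[(\rho_{XA}\otimes\rho_{AB}\otimes\rho_{BY})(E_x\otimes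 E_a\otimes E_b\otimes E_y)\big].$$ * $p(a,b|x,y)$ is *quantum in the Bell scenario* if there are complex Hilbert spaces $H,K$, a state $\rho$ on $H\otimes K$, and POVMs $(A^x_a)_a$ on $H$ for every $x$ and $(B^y_b)_b$ on $K$ for every $y$ such that $p(a,b|x,y)=\operatorname{tr}[\rho\,(A^x_a\otimes B^y_b)]$. -/

import Mathlib

open MeasureTheory
open scoped TensorProduct

universe u

noncomputable section

/-! ### Hilbert space tensor products -/

/-- The Hilbert space tensor product: the completion of the algebraic tensor product with respect to
the inner product determined by `⟪x ⊗ y, x' ⊗ y'⟫ = ⟪x, x'⟫ * ⟪y, y'⟫`. -/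
def HilbertTensor (H K : Type*) [NormedAddCommGroup H] [InnerProductSpace ℂ H]
    [NormedAddCommGroup K] [InnerProductSpace ℂ K] : Type _ :=
  UniformSpace.Completion (H ⊗[ℂ] K)

infixr:100 " ⊗ₕ " => HilbertTensor

namespace HilbertTensor

section

variable {H K L H' K' : Type*}
  [NormedAddCommGroup H] [InnerProductSpace ℂ H]
  [NormedAddCommGroup K] [InnerProductSpace ℂ K]
  [NormedAddCommGroup L] [InnerProductSpace ℂ L]
  [NormedAddCommGroup H'] [InnerProductSpace ℂ H']
  [NormedAddCommGroup K'] [InnerProductSpace ℂ K']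

instance : NormedAddCommGroup (H ⊗ₕ K) :=
  inferInstanceAs (NormedAddCommGroup (UniformSpace.Completion (H ⊗[ℂ] K)))

instance : InnerProductSpace ℂ (H ⊗ₕ K) :=
  inferInstanceAs (InnerProductSpace ℂ (UniformSpace.Completion (H ⊗[ℂ] K)))

instance : CompleteSpace (H ⊗ₕ K) :=
  inferInstanceAs (CompleteSpace (UniformSpace.Completion (H ⊗[ℂ] K)))

variable (H K) in
/-- The dense isometric inclusion of the algebraic tensor product. -/
def incl : H ⊗[ℂ] K →ₗᵢ[ℂ] H ⊗ₕ K :=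
  UniformSpace.Completion.toComplₗᵢ (𝕜 := ℂ) (E := H ⊗[ℂ] K)

/-- The elementary tensor `x ⊗ y`. -/
def tmul (x : H) (y : K) : H ⊗ₕ K := incl H K (x ⊗ₜ[ℂ] y)

theorem denseRange_incl : DenseRange (incl H K) :=
  UniformSpace.Completion.denseRange_coe

theorem inner_tmul_tmul (x x' : H) (y y' : K) :
    inner ℂ (tmul x y) (tmul x' y') = inner ℂ x x' * inner ℂ y y' := by
  simp [tmul]

/-- The tensor product `S ⊗ T` of two bounded operators. -/
def map (S : H →L[ℂ] H') (T : K →L[ℂ] K') : H ⊗ₕ K →L[ℂ] H' ⊗ₕ K' :=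
  ContinuousLinearMap.completion (TensorProduct.mapL S T)

theorem map_tmul (S : H →L[ℂ] H') (T : K →L[ℂ] K') (x : H) (y : K) :
    map S T (tmul x y) = tmul (S x) (T y) :=
  ContinuousLinearMap.completion_apply_coe (TensorProduct.mapL S T) (x ⊗ₜ[ℂ] y)

/-- The unitary `f ⊗ g` for unitaries `f` and `g`. -/
def congr (f : H ≃ₗᵢ[ℂ] H') (g : K ≃ₗᵢ[ℂ] K') : H ⊗ₕ K ≃ₗᵢ[ℂ] H' ⊗ₕ K' :=
  (TensorProduct.congrIsometry f g).toLinearEquiv.extendOfIsometry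
    (incl H K).toLinearMap (incl H' K').toLinearMap denseRange_incl denseRange_incl
    (fun x => ((incl H' K').norm_map _).trans
      (((TensorProduct.congrIsometry f g).norm_map x).trans ((incl H K).norm_map x).symm))

theorem congr_tmul (f : H ≃ₗᵢ[ℂ] H') (g : K ≃ₗᵢ[ℂ] K') (x : H) (y : K) :
    congr f g (tmul x y) = tmul (f x) (g y) :=
  LinearEquiv.extendOfIsometry_eq _ _ _ _ _ _ (x ⊗ₜ[ℂ] y)

variable (H K L) in
/-- The inclusion of the algebraic triple tensor product into `(H ⊗ₕ K) ⊗ₕ L`. -/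
def inclLeft : (H ⊗[ℂ] K) ⊗[ℂ] L →ₗᵢ[ℂ] (H ⊗ₕ K) ⊗ₕ L :=
  (incl (H ⊗ₕ K) L).comp (TensorProduct.mapIsometry (incl H K) LinearIsometry.id)

variable (H K L) in
/-- The inclusion of the algebraic triple tensor product into `H ⊗ₕ (K ⊗ₕ L)`. -/
def inclRight : H ⊗[ℂ] (K ⊗[ℂ] L) →ₗᵢ[ℂ] H ⊗ₕ (K ⊗ₕ L) :=
  (incl H (K ⊗ₕ L)).comp (TensorProduct.mapIsometry LinearIsometry.id (incl K L))

theorem continuous_tmul : Continuous fun z : H × K => tmul z.1 z.2 :=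
  (incl H K).continuous.comp TensorProduct.continuous_tmul

theorem denseRange_mapIsometry {f : H →ₗᵢ[ℂ] H'} {g : K →ₗᵢ[ℂ] K'}
    (hf : DenseRange f) (hg : DenseRange g) :
    DenseRange ((incl H' K').comp (TensorProduct.mapIsometry f g)) := by
  set φ := (incl H' K').comp (TensorProduct.mapIsometry f g) with hφ
  let S : Submodule ℂ (H' ⊗ₕ K') := (LinearMap.range φ.toLinearMap).topologicalClosure
  have hS : ∀ x y, tmul x y ∈ S := by
    intro x y
    refine hf.induction_on (p := fun x => tmul x y ∈ S) x ?_ fun a => ?_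
    · exact (Submodule.isClosed_topologicalClosure _).preimage
        (continuous_tmul.comp (Continuous.prodMk_left y))
    refine hg.induction_on (p := fun y => tmul (f a) y ∈ S) y ?_ fun b => ?_
    · exact (Submodule.isClosed_topologicalClosure _).preimage
        (continuous_tmul.comp (Continuous.prodMk_right (f a)))
    exact Submodule.le_topologicalClosure _ ⟨a ⊗ₜ[ℂ] b, by simp [hφ, tmul]⟩
  have hS' : ∀ t : H' ⊗[ℂ] K', incl H' K' t ∈ S := by
    intro t
    induction t using TensorProduct.induction_on with
    | zero => simp
    | tmul x y => exact hS x y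
    | add s t hs ht => rw [map_add]; exact S.add_mem hs ht
  intro z
  change z ∈ (S : Set (H' ⊗ₕ K'))
  refine denseRange_incl.induction_on (p := fun z => z ∈ (S : Set (H' ⊗ₕ K'))) z ?_ hS'
  exact Submodule.isClosed_topologicalClosure _

variable (H K L) in
/-- The associativity unitary `(x ⊗ y) ⊗ z ↦ x ⊗ (y ⊗ z)`. -/
def assoc : (H ⊗ₕ K) ⊗ₕ L ≃ₗᵢ[ℂ] H ⊗ₕ (K ⊗ₕ L) :=
  (TensorProduct.assoc ℂ H K L).extendOfIsometry
    (inclLeft H K L).toLinearMap (inclRight H K L).toLinearMap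
    (denseRange_mapIsometry denseRange_incl denseRange_id)
    (denseRange_mapIsometry denseRange_id denseRange_incl)
    (fun x => ((inclRight H K L).norm_map _).trans
      (((TensorProduct.assocIsometry ℂ H K L).norm_map x).trans ((inclLeft H K L).norm_map x).symm))

theorem assoc_tmul (x : H) (y : K) (z : L) :
    assoc H K L (tmul (tmul x y) z) = tmul x (tmul y z) :=
  LinearEquiv.extendOfIsometry_eq (TensorProduct.assoc ℂ H K L) (inclLeft H K L).toLinearMap
    (inclRight H K L).toLinearMap _ _ _ ((x ⊗ₜ[ℂ] y) ⊗ₜ[ℂ] z)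

end

end HilbertTensor

/-! ### States and measurements -/

section QuantumBasics

variable {H : Type u} [NormedAddCommGroup H] [InnerProductSpace ℂ H] [CompleteSpace H]

/-- `T` has a trace, equal to `c`: for every orthonormal basis `b`, the series `∑ i, ⟪b i, T (b i)⟫`
converges (unconditionally, hence absolutely) to `c`. For a positive operator this says that `T` is
trace-class with trace `c`. -/
def HasTrace (T : H →L[ℂ] H) (c : ℂ) : Prop :=
  ∀ (ι : Type u) (b : HilbertBasis ι ℂ H), HasSum (fun i => inner ℂ (b i) (T (b i))) c

/-- Quantum states: positive trace-class operators of unit trace. -/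
def IsQuantumState (ρ : H →L[ℂ] H) : Prop :=
  ρ.IsPositive ∧ HasTrace ρ 1

/-- `F` is a POVM with (finite) outcome set `O`. -/
def IsPOVM {O : Type*} [Fintype O] (F : O → H →L[ℂ] H) : Prop :=
  (∀ o, (F o).IsPositive) ∧ ∑ o, F o = 1

/-- A bundled complex Hilbert space of arbitrary dimension. -/
structure HilbertSpaceBundle : Type (u + 1) where
  carrier : Type u
  [normedAddCommGroup : NormedAddCommGroup carrier]
  [innerProductSpace : InnerProductSpace ℂ carrier]
  [completeSpace : CompleteSpace carrier]

instance : CoeSort HilbertSpaceBundle (Type u) := ⟨HilbertSpaceBundle.carrier⟩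

attribute [instance] HilbertSpaceBundle.normedAddCommGroup HilbertSpaceBundle.innerProductSpace
  HilbertSpaceBundle.completeSpace

end QuantumBasics

/-! ### Hidden variables and conditional distributions -/

/-- `f o` represents the conditional probability `p(o | ω)`, `o` ranging over a finite outcome set:
a family of (representatives of) nonnegative elements of `L^∞(μ)` summing to `1`. -/
def IsConditionalDistribution {Ω O : Type*} [MeasurableSpace Ω] [Fintype O] (μ : Measure Ω)
    (f : O → Ω → ℝ) : Prop :=
  (∀ o, AEMeasurable (f o) μ) ∧ (∀ o, ∀ᵐ ω ∂μ, 0 ≤ f o ω) ∧ ∀ᵐ ω ∂μ, ∑ o, f o ω = 1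

/-- A hidden variable: an arbitrary probability space. -/
structure HiddenVariable : Type (u + 1) where
  carrier : Type u
  [measurableSpace : MeasurableSpace carrier]
  dist : Measure carrier
  [isProbabilityMeasure : IsProbabilityMeasure dist]

attribute [instance] HiddenVariable.measurableSpace HiddenVariable.isProbabilityMeasure

/-! ### The path scenario `P₄`: parties `X - A - B - Y` -/

namespace P4

section Distributions

variable {X A B Y : Type*} [Fintype X] [Fintype A] [Fintype B] [Fintype Y]

/-- The marginal `p(x)`. -/
def margX (p : X → A → B → Y → ℝ) (x : X) : ℝ := ∑ a, ∑ b, ∑ y, p x a b y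

/-- The marginal `p(y)`. -/
def margY (p : X → A → B → Y → ℝ) (y : Y) : ℝ := ∑ x, ∑ a, ∑ b, p x a b y

/-- The marginal `p(x, y)`. -/
def margXY (p : X → A → B → Y → ℝ) (x : X) (y : Y) : ℝ := ∑ a, ∑ b, p x a b y

/-- The marginal `p(x, a)`. -/
def margXA (p : X → A → B → Y → ℝ) (x : X) (a : A) : ℝ := ∑ b, ∑ y, p x a b y

/-- The marginal `p(b, y)`. -/
def margBY (p : X → A → B → Y → ℝ) (b : B) (y : Y) : ℝ := ∑ x, ∑ a, p x a b y

/-- The marginal `p(x, a, y)`. -/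
def margXAY (p : X → A → B → Y → ℝ) (x : X) (a : A) (y : Y) : ℝ := ∑ b, p x a b y

/-- The marginal `p(x, b, y)`. -/
def margXBY (p : X → A → B → Y → ℝ) (x : X) (b : B) (y : Y) : ℝ := ∑ a, p x a b y

/-- A correlation in the `P₄` scenario: a probability distribution `p(x, a, b, y)` with
`p(x, a, y) = p(x, a) p(y)` and `p(x, b, y) = p(x) p(b, y)`. -/
structure IsCorrelation (p : X → A → B → Y → ℝ) : Prop where
  nonneg : ∀ x a b y, 0 ≤ p x a b y
  sum_eq_one : ∑ x, ∑ a, ∑ b, ∑ y, p x a b y = 1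
  indep_y : ∀ x a y, margXAY p x a y = margXA p x a * margY p y
  indep_x : ∀ x b y, margXBY p x b y = margX p x * margBY p b y

/-- The conditional distribution `p(a, b | x, y)`, as a function of the settings `x`, `y` and then the
outcomes `a`, `b`; meaningful when `p(x, y) > 0`. -/
def cond (p : X → A → B → Y → ℝ) (x : X) (y : Y) (a : A) (b : B) : ℝ :=
  p x a b y / margXY p x y

end Distributions

section Classical

/-- A hidden variable model in `P₄`: one independent hidden variable for each of the three sources,
and for each party a conditional outcome distribution given the hidden variables of the adjacent
sources. -/
structure ClassicalModel (X A B Y : Type*) [Fintype X] [Fintype A] [Fintype B] [Fintype Y] where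
  sXA : HiddenVariable.{u}
  sAB : HiddenVariable.{u}
  sBY : HiddenVariable.{u}
  fX : X → sXA.carrier → ℝ
  fA : A → sXA.carrier × sAB.carrier → ℝ
  fB : B → sAB.carrier × sBY.carrier → ℝ
  fY : Y → sBY.carrier → ℝ
  hX : IsConditionalDistribution sXA.dist fX
  hA : IsConditionalDistribution (sXA.dist.prod sAB.dist) fA
  hB : IsConditionalDistribution (sAB.dist.prod sBY.dist) fB
  hY : IsConditionalDistribution sBY.dist fY

variable {X A B Y : Type*} [Fintype X] [Fintype A] [Fintype B] [Fintype Y]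

/-- The probability `∫ p(x|λ_XA) p(a|λ_XA,λ_AB) p(b|λ_AB,λ_BY) p(y|λ_BY)` over the three independent
hidden variables. -/
def ClassicalModel.prob (M : ClassicalModel.{u} X A B Y) (x : X) (a : A) (b : B) (y : Y) : ℝ :=
  ∫ l : M.sXA.carrier × M.sAB.carrier × M.sBY.carrier,
    M.fX x l.1 * M.fA a (l.1, l.2.1) * M.fB b (l.2.1, l.2.2) * M.fY y l.2.2
    ∂(M.sXA.dist.prod (M.sAB.dist.prod M.sBY.dist))

/-- `p` is classical in `P₄`. -/
def IsClassical (p : X → A → B → Y → ℝ) : Prop :=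
  ∃ M : ClassicalModel.{u} X A B Y, ∀ x a b y, p x a b y = M.prob x a b y

end Classical

section Quantum

open HilbertTensor

/-- A quantum model in `P₄`: a Hilbert space for every pair of a source and an adjacent party, a
state for each of the three sources and a POVM for each of the four parties, acting on all the
systems received by that party. `HXA` is the system sent to `X` by the source between `X` and `A`,
`HAX` the one sent to `A` by that same source, and so on. -/
structure QuantumModel (X A B Y : Type*) [Fintype X] [Fintype A] [Fintype B] [Fintype Y] where
  (HXA HAX HAB HBA HBY HYB : HilbertSpaceBundle.{u})
  ρXA : HXA ⊗ₕ HAX →L[ℂ] HXA ⊗ₕ HAX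
  ρAB : HAB ⊗ₕ HBA →L[ℂ] HAB ⊗ₕ HBA
  ρBY : HBY ⊗ₕ HYB →L[ℂ] HBY ⊗ₕ HYB
  EX : X → HXA →L[ℂ] HXA
  EA : A → HAX ⊗ₕ HAB →L[ℂ] HAX ⊗ₕ HAB
  EB : B → HBA ⊗ₕ HBY →L[ℂ] HBA ⊗ₕ HBY
  EY : Y → HYB →L[ℂ] HYB
  stateXA : IsQuantumState ρXA
  stateAB : IsQuantumState ρAB
  stateBY : IsQuantumState ρBY
  povmX : IsPOVM EX
  povmA : IsPOVM EA
  povmB : IsPOVM EB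
  povmY : IsPOVM EY

variable {X A B Y : Type*} [Fintype X] [Fintype A] [Fintype B] [Fintype Y]

namespace QuantumModel

variable (M : QuantumModel.{u} X A B Y)

/-- The total Hilbert space, its six factors grouped according to the sources. -/
abbrev SourceSpace : Type u := (M.HXA ⊗ₕ M.HAX) ⊗ₕ (M.HAB ⊗ₕ M.HBA) ⊗ₕ (M.HBY ⊗ₕ M.HYB)

/-- The total Hilbert space, its six factors grouped according to the parties. -/
abbrev PartySpace : Type u := M.HXA ⊗ₕ (M.HAX ⊗ₕ M.HAB) ⊗ₕ (M.HBA ⊗ₕ M.HBY) ⊗ₕ M.HYB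

/-- The regrouping of the six tensor factors. -/
def regroup : M.SourceSpace ≃ₗᵢ[ℂ] M.PartySpace :=
  (assoc M.HXA M.HAX ((M.HAB ⊗ₕ M.HBA) ⊗ₕ (M.HBY ⊗ₕ M.HYB))).trans
    (HilbertTensor.congr (LinearIsometryEquiv.refl ℂ M.HXA)
      ((HilbertTensor.congr (LinearIsometryEquiv.refl ℂ M.HAX)
        ((assoc M.HAB M.HBA (M.HBY ⊗ₕ M.HYB)).trans
          (HilbertTensor.congr (LinearIsometryEquiv.refl ℂ M.HAB) (assoc M.HBA M.HBY M.HYB).symm))).trans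
        (assoc M.HAX M.HAB ((M.HBA ⊗ₕ M.HBY) ⊗ₕ M.HYB)).symm))

/-- The joint state `ρ_XA ⊗ ρ_AB ⊗ ρ_BY`. -/
def state : M.SourceSpace →L[ℂ] M.SourceSpace := map M.ρXA (map M.ρAB M.ρBY)

/-- The joint effect `E_x ⊗ E_a ⊗ E_b ⊗ E_y`. -/
def effect (x : X) (a : A) (b : B) (y : Y) : M.PartySpace →L[ℂ] M.PartySpace :=
  map (M.EX x) (map (M.EA a) (map (M.EB b) (M.EY y)))

/-- The joint effect, transported to the space on which the joint state acts. -/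
def effectOnSources (x : X) (a : A) (b : B) (y : Y) : M.SourceSpace →L[ℂ] M.SourceSpace :=
  (M.regroup.symm : M.PartySpace →L[ℂ] M.SourceSpace) ∘L M.effect x a b y ∘L
    (M.regroup : M.SourceSpace →L[ℂ] M.PartySpace)

theorem regroup_tmul (x₁ : M.HXA) (a₁ : M.HAX) (a₂ : M.HAB) (b₁ : M.HBA) (b₂ : M.HBY)
    (y₁ : M.HYB) :
    M.regroup (tmul (tmul x₁ a₁) (tmul (tmul a₂ b₁) (tmul b₂ y₁))) =
      tmul x₁ (tmul (tmul a₁ a₂) (tmul (tmul b₁ b₂) y₁)) := by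
  have h1 : (assoc M.HBA M.HBY M.HYB).symm (tmul b₁ (tmul b₂ y₁)) = tmul (tmul b₁ b₂) y₁ := by
    rw [LinearIsometryEquiv.symm_apply_eq, assoc_tmul]
  have h2 : (assoc M.HAX M.HAB ((M.HBA ⊗ₕ M.HBY) ⊗ₕ M.HYB)).symm
      (tmul a₁ (tmul a₂ (tmul (tmul b₁ b₂) y₁))) =
        tmul (tmul a₁ a₂) (tmul (tmul b₁ b₂) y₁) := by
    rw [LinearIsometryEquiv.symm_apply_eq, assoc_tmul]
  simp only [regroup, LinearIsometryEquiv.trans_apply, assoc_tmul, congr_tmul, h1, h2,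
    LinearIsometryEquiv.coe_refl, id_eq]

end QuantumModel

/-- `p` is quantum in `P₄`: `p(x, a, b, y) = tr[(⨂ states) (⨂ effects)]`. -/
def IsQuantum (p : X → A → B → Y → ℝ) : Prop :=
  ∃ M : QuantumModel.{u} X A B Y, ∀ x a b y,
    HasTrace (M.state ∘L M.effectOnSources x a b y) (p x a b y : ℂ)

end Quantum

end P4

/-! ### The bipartite Bell scenario with settings `x`, `y` and outcomes `a`, `b` -/

namespace Bell

variable {X A B Y : Type*} [Fintype A] [Fintype B]

/-- `q(a, b | x, y)` is classical (local) in the Bell scenario: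
`q(a, b | x, y) = ∫ p(a | x, λ) p(b | y, λ)` for a hidden variable `λ`. -/
def IsClassical (q : X → Y → A → B → ℝ) : Prop :=
  ∃ (s : HiddenVariable.{u}) (f : X → A → s.carrier → ℝ) (g : Y → B → s.carrier → ℝ),
    (∀ x, IsConditionalDistribution s.dist (f x)) ∧
    (∀ y, IsConditionalDistribution s.dist (g y)) ∧
    ∀ x y a b, q x y a b = ∫ l, f x a l * g y b l ∂s.dist

/-- `q(a, b | x, y)` is quantum in the Bell scenario: `q(a, b | x, y) = tr[ρ (E^x_a ⊗ F^y_b)]` for a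
state `ρ` on `H ⊗ K` and POVMs `E^x` on `H` and `F^y` on `K`. -/
def IsQuantum (q : X → Y → A → B → ℝ) : Prop :=
  ∃ (H K : HilbertSpaceBundle.{u}) (ρ : H ⊗ₕ K →L[ℂ] H ⊗ₕ K)
    (E : X → A → H →L[ℂ] H) (F : Y → B → K →L[ℂ] K),
    IsQuantumState ρ ∧ (∀ x, IsPOVM (E x)) ∧ (∀ y, IsPOVM (F y)) ∧
    ∀ x y a b, HasTrace (ρ ∘L HilbertTensor.map (E x a) (F y b)) (q x y a b : ℂ)

end Bell

end

/-!
The statement compares a network with independent sources at `X - A`, `A - B` and `B - Y` to a Bell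
scenario in which `x` and `y` are settings. The bridge is that an outcome `x` which is independent of
everything on the far side can be exchanged for a setting.

From the network to the Bell scenario, the outer sources are absorbed into the parties `A` and `B`.
Classically, averaging `p(x|k) p(a|k,l)` over the hidden variable `k` of the source `X - A` gives a
function of the hidden variable `l` of the middle source which is `p(x)` times a response function of
`A` with setting `x` (`P4.average`, `P4.sum_average`). In the quantum case, `slice` is the partial
trace of `(ρ ⊗ 1) (Eₓ ⊗ Eₐ)` over the outer source, and
`P4.QuantumModel.hasTrace_state_comp` says that the network probability is the trace of `ρ_AB` against
the tensor product of the slices on the two sides. Since `∑ₐ Eₐ = 1`, the slices sum over `a` to a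
multiple of the identity (`P4.QuantumModel.sum_slice_left`), and comparing with the marginals shows
that this multiple is `p(x)`; dividing by it gives a POVM for every `x`.

From the Bell scenario to the network, the source `X - A` sends two perfectly correlated classical
copies of a random `x`, distributed as `p(x)`. The party `X` reports its copy and `A` uses its copy as
the setting (`P4.copyState`, `P4.readLeft`, `P4.isConditionalDistribution_label`). The same formulas
as before then compute the resulting probability as `p(x) p(y) p(a,b|x,y)`, which is `p(x,a,b,y)`
because `x` and `y` are independent.

Traces in arbitrary dimension are handled by writing a state as a norm convergent sum of rank one
operators `|vᵢ⟩⟨vᵢ|` with `∑ ‖vᵢ‖² < ∞` (`IsMixture`; the vectors `√ρ bᵢ` for a Hilbert basis `b` will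
do, so no spectral theorem is needed). Then `tr (ρ T) = ∑ ⟨vᵢ, T vᵢ⟩` in every basis, for every
bounded `T` (`IsMixture.hasTrace_comp`).
-/

noncomputable section

/-! ### Operators on Hilbert space tensor products -/

namespace HilbertTensor

variable {H K H' K' H'' K'' G : Type*}
  [NormedAddCommGroup H] [InnerProductSpace ℂ H]
  [NormedAddCommGroup K] [InnerProductSpace ℂ K]
  [NormedAddCommGroup H'] [InnerProductSpace ℂ H']
  [NormedAddCommGroup K'] [InnerProductSpace ℂ K']
  [NormedAddCommGroup H''] [InnerProductSpace ℂ H'']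
  [NormedAddCommGroup K''] [InnerProductSpace ℂ K'']
  [NormedAddCommGroup G] [InnerProductSpace ℂ G]

theorem clm_ext {S T : H ⊗ₕ K →L[ℂ] G} (h : ∀ x y, S (tmul x y) = T (tmul x y)) : S = T := by
  ext z
  refine denseRange_incl.induction_on (p := fun z => S z = T z) z
    (isClosed_eq S.continuous T.continuous) fun t => ?_
  induction t using TensorProduct.induction_on with
  | zero => simp
  | tmul x y => exact h x y
  | add s t hs ht => simp only [map_add, hs, ht]

theorem norm_tmul (x : H) (y : K) : ‖tmul x y‖ = ‖x‖ * ‖y‖ := by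
  simp [tmul]

variable (H K) in
/-- The elementary tensor `x ⊗ y` as a continuous bilinear map of `x` and `y`. -/
def tmulCLM : H →L[ℂ] K →L[ℂ] H ⊗ₕ K :=
  ((TensorProduct.mk ℂ H K).compr₂ (incl H K).toLinearMap).mkContinuous₂ 1 fun x y => by
    simp

@[simp]
theorem tmulCLM_apply (x : H) (y : K) : tmulCLM H K x y = tmul x y := rfl

theorem add_tmul (x x' : H) (y : K) : tmul (x + x') y = tmul x y + tmul x' y := by
  simp [← tmulCLM_apply]

theorem tmul_add (x : H) (y y' : K) : tmul x (y + y') = tmul x y + tmul x y' :=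
  _root_.map_add (tmulCLM H K x) y y'

theorem smul_tmul (c : ℂ) (x : H) (y : K) : tmul (c • x) y = c • tmul x y := by
  simp [← tmulCLM_apply]

theorem tmul_smul (c : ℂ) (x : H) (y : K) : tmul x (c • y) = c • tmul x y :=
  _root_.map_smul (tmulCLM H K x) c y

theorem map_comp (S' : H' →L[ℂ] H'') (S : H →L[ℂ] H') (T' : K' →L[ℂ] K'') (T : K →L[ℂ] K') :
    map (S' ∘L S) (T' ∘L T) = map S' T' ∘L map S T :=
  clm_ext fun x y => by simp [map_tmul]

@[simp]
theorem map_one_one : map (1 : H →L[ℂ] H) (1 : K →L[ℂ] K) = 1 :=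
  clm_ext fun x y => by simp [map_tmul]

@[simp]
theorem zero_tmul (y : K) : tmul (0 : H) y = 0 := by
  simp [tmul]

@[simp]
theorem tmul_zero (x : H) : tmul x (0 : K) = 0 := by
  simp [tmul]

variable (H K H' K') in
/-- The tensor product `S ⊗ T` of operators as a continuous bilinear map of `S` and `T`. -/
def mapCLM : (H →L[ℂ] H') →L[ℂ] (K →L[ℂ] K') →L[ℂ] (H ⊗ₕ K →L[ℂ] H' ⊗ₕ K') :=
  LinearMap.mkContinuous₂
    (LinearMap.mk₂ ℂ (fun (S : H →L[ℂ] H') (T : K →L[ℂ] K') => map S T)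
      (fun S S' T => clm_ext fun x y => by
        simp [map_tmul, add_tmul])
      (fun c S T => clm_ext fun x y => by
        simp [map_tmul, smul_tmul])
      (fun S T T' => clm_ext fun x y => by
        simp [map_tmul, tmul_add])
      (fun c S T => clm_ext fun x y => by
        simp [map_tmul, tmul_smul])) 1
    fun S T => by
      rw [one_mul]
      refine ContinuousLinearMap.opNorm_le_bound _ (by positivity) fun z => ?_
      refine denseRange_incl.induction_on (p := fun z => ‖map S T z‖ ≤ ‖S‖ * ‖T‖ * ‖z‖) z
        (isClosed_le (by fun_prop) (by fun_prop)) fun t => ?_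
      have h1 : map S T (incl H K t) = incl H' K' (TensorProduct.mapL S T t) :=
        ContinuousLinearMap.completion_apply_coe _ _
      rw [h1, LinearIsometry.norm_map, LinearIsometry.norm_map]
      exact (ContinuousLinearMap.le_opNorm _ _).trans
        (mul_le_mul_of_nonneg_right (TensorProduct.norm_mapL_le S T) (norm_nonneg _))

@[simp]
theorem mapCLM_apply (S : H →L[ℂ] H') (T : K →L[ℂ] K') : mapCLM H K H' K' S T = map S T := rfl

theorem map_smul_smul (c d : ℂ) (S : H →L[ℂ] H') (T : K →L[ℂ] K') :
    map (c • S) (d • T) = (c * d) • map S T :=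
  clm_ext fun x y => by simp [map_tmul, smul_tmul, tmul_smul, smul_smul, mul_comm]

/-- Two operators on a tensor product agree if their matrix elements between elementary tensors do. -/
theorem clm_ext_inner {S T : H ⊗ₕ K →L[ℂ] H' ⊗ₕ K'}
    (h : ∀ x y x' y', inner ℂ (tmul x' y') (S (tmul x y)) = inner ℂ (tmul x' y') (T (tmul x y))) :
    S = T := by
  refine clm_ext fun x y => ext_inner_left ℂ fun z => ?_
  have : innerSL ℂ (S (tmul x y)) = innerSL ℂ (T (tmul x y)) := clm_ext fun x' y' => by
    have := congrArg (starRingEnd ℂ) (h x y x' y')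
    simpa only [inner_conj_symm, innerSL_apply_apply] using this
  have := congrArg (starRingEnd ℂ) (DFunLike.congr_fun this z)
  simpa only [inner_conj_symm, innerSL_apply_apply] using this

variable [CompleteSpace H] [CompleteSpace K] [CompleteSpace H'] [CompleteSpace K']

theorem adjoint_map (S : H →L[ℂ] H') (T : K →L[ℂ] K') :
    (map S T).adjoint = map S.adjoint T.adjoint := by
  refine clm_ext_inner fun x y x' y' => ?_
  rw [ContinuousLinearMap.adjoint_inner_right, map_tmul, map_tmul, inner_tmul_tmul, inner_tmul_tmul,
    ContinuousLinearMap.adjoint_inner_right, ContinuousLinearMap.adjoint_inner_right]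

/-- The tensor product of positive operators is positive, since `Q†Q ⊗ R†R = (Q ⊗ R)† (Q ⊗ R)`. -/
theorem isPositive_map {S : H →L[ℂ] H} {T : K →L[ℂ] K} (hS : S.IsPositive) (hT : T.IsPositive) :
    (map S T).IsPositive := by
  rw [← ContinuousLinearMap.nonneg_iff_isPositive] at hS hT
  obtain ⟨Q, rfl⟩ := CStarAlgebra.nonneg_iff_eq_star_mul_self.1 hS
  obtain ⟨R, rfl⟩ := CStarAlgebra.nonneg_iff_eq_star_mul_self.1 hT
  have h : map (star Q * Q) (star R * R) = (map Q R).adjoint ∘L map Q R := by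
    rw [adjoint_map, ← map_comp]
    rfl
  rw [h]
  exact ContinuousLinearMap.isPositive_adjoint_comp_self _

end HilbertTensor

/-! ### Mixtures of vectors and traces -/

section Mixtures
open InnerProductSpace

variable {ι κ : Type*} {H K : Type*}
  [NormedAddCommGroup H] [InnerProductSpace ℂ H]
  [NormedAddCommGroup K] [InnerProductSpace ℂ K]

/-- The positive operator `ρ` is the sum of the rank one operators `|vᵢ⟩⟨vᵢ|`, where `∑ ‖vᵢ‖²` converges.
The vectors need not
be normalized or orthogonal. -/
structure IsMixture (ρ : H →L[ℂ] H) (v : ι → H) : Prop where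
  summable : Summable fun i => ‖v i‖ ^ 2
  hasSum : HasSum (fun i => rankOne ℂ (v i) (v i)) ρ

theorem summable_rankOne [CompleteSpace H] {v : ι → H} (hv : Summable fun i => ‖v i‖ ^ 2) :
    Summable fun i => rankOne ℂ (v i) (v i) :=
  Summable.of_norm (by simpa [sq] using hv)

theorem HilbertBasis.summable_prod_norm_inner_sq (b : HilbertBasis κ ℂ H) {z : ι → H}
    (hz : Summable fun i => ‖z i‖ ^ 2) :
    Summable fun q : ι × κ => ‖inner ℂ (b q.2) (z q.1)‖ ^ 2 := by
  have h1 : ∀ x : H, HasSum (fun k => ‖inner ℂ (b k) x‖ ^ 2) (‖x‖ ^ 2) := by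
    intro x
    have := b.hasSum_inner_mul_inner x x
    have := Complex.hasSum_re this
    convert this using 1
    · ext k
      rw [← inner_conj_symm x, Complex.conj_mul']
      norm_cast
    · rw [inner_self_eq_norm_sq_to_K]
      norm_cast
  rw [summable_prod_of_nonneg (fun _ => by positivity)]
  exact ⟨fun i => (h1 (z i)).summable, by simpa only [(h1 _).tsum_eq] using hz⟩

namespace IsMixture
variable {ρ : H →L[ℂ] H} {v : ι → H} {σ : K →L[ℂ] K} {w : κ → K}

theorem hasSum_inner (h : IsMixture ρ v) (x y : H) :
    HasSum (fun i => inner ℂ x (v i) * inner ℂ (v i) y) (inner ℂ x (ρ y)) := by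
  have h1 := (innerSL ℂ x).hasSum ((ContinuousLinearMap.apply ℂ H y).hasSum h.hasSum)
  simpa [inner_smul_right, mul_comm] using h1

theorem isPositive [CompleteSpace H] (h : IsMixture ρ v) : ρ.IsPositive := by
  rw [← ContinuousLinearMap.nonneg_iff_isPositive]
  refine h.hasSum.nonneg fun i => ?_
  rw [ContinuousLinearMap.nonneg_iff_isPositive]
  exact isPositive_rankOne_self _

theorem summable_inner (h : IsMixture ρ v) (T : H →L[ℂ] H) :
    Summable fun i => inner ℂ (v i) (T (v i)) := by
  refine Summable.of_norm_bounded (h.summable.mul_left ‖T‖) fun i => ?_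
  calc _ ≤ ‖v i‖ * ‖T (v i)‖ := norm_inner_le_norm _ _
    _ ≤ ‖v i‖ * (‖T‖ * ‖v i‖) := by gcongr; exact T.le_opNorm _
    _ = _ := by ring

/-- Both iterated sums of `⟪bₖ, vᵢ⟫ ⟪vᵢ, T bₖ⟫` converge absolutely; summing over `k` first gives the
basis-independent value `∑ᵢ ⟪vᵢ, T vᵢ⟫`. -/
theorem hasTrace_comp {H : Type u} [NormedAddCommGroup H] [InnerProductSpace ℂ H] [CompleteSpace H]
    {ρ : H →L[ℂ] H} {v : ι → H} (h : IsMixture ρ v) (T : H →L[ℂ] H) :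
    HasTrace (ρ ∘L T) (∑' i, inner ℂ (v i) (T (v i))) := by
  intro κ b
  have hs : Summable fun q : ι × κ =>
      inner ℂ (b q.2) (v q.1) * inner ℂ (v q.1) (T (b q.2)) := by
    have h2 : Summable fun i => ‖T.adjoint (v i)‖ ^ 2 := by
      refine Summable.of_nonneg_of_le (fun _ => by positivity) (fun i => ?_)
        (h.summable.mul_left (‖T.adjoint‖ ^ 2))
      rw [← mul_pow]
      gcongr
      exact T.adjoint.le_opNorm _
    refine Summable.of_norm_bounded
      ((b.summable_prod_norm_inner_sq h.summable).add (b.summable_prod_norm_inner_sq h2))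
      fun q => ?_
    rw [← ContinuousLinearMap.adjoint_inner_left, norm_mul, norm_inner_symm (T.adjoint _)]
    nlinarith [sq_nonneg (‖inner ℂ (b q.2) (v q.1)‖ - ‖inner ℂ (b q.2) (T.adjoint (v q.1))‖),
      sq_nonneg (‖inner ℂ (b q.2) (v q.1)‖ + ‖inner ℂ (b q.2) (T.adjoint (v q.1))‖)]
  have h1 : HasSum (fun i => inner ℂ (v i) (T (v i))) (∑' q : ι × κ,
      inner ℂ (b q.2) (v q.1) * inner ℂ (v q.1) (T (b q.2))) := by
    refine hs.hasSum.prod_fiberwise fun i => ?_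
    have := b.hasSum_inner_mul_inner (T.adjoint (v i)) (v i)
    rw [ContinuousLinearMap.adjoint_inner_left] at this
    simpa only [ContinuousLinearMap.adjoint_inner_left, mul_comm] using this
  rw [h1.tsum_eq]
  exact ((Equiv.prodComm κ ι).hasSum_iff.mpr hs.hasSum).prod_fiberwise
    fun k => h.hasSum_inner (b k) (T (b k))

theorem map (hv : IsMixture ρ v) (hw : IsMixture σ w) :
    IsMixture (HilbertTensor.map ρ σ) fun q : ι × κ => HilbertTensor.tmul (v q.1) (w q.2) := by
  have hs : Summable fun q : ι × κ => ‖HilbertTensor.tmul (v q.1) (w q.2)‖ ^ 2 := by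
    simpa only [HilbertTensor.norm_tmul, mul_pow] using
      hv.summable.mul_of_nonneg hw.summable (fun _ => by positivity) (fun _ => by positivity)
  have h : IsMixture (∑' q : ι × κ, _) _ := ⟨hs, (summable_rankOne hs).hasSum⟩
  convert h using 1
  refine HilbertTensor.clm_ext_inner fun x y x' y' => ?_
  have h1 := h.hasSum_inner (HilbertTensor.tmul x' y') (HilbertTensor.tmul x y)
  simp only [HilbertTensor.inner_tmul_tmul, HilbertTensor.map_tmul] at h1 ⊢
  have ha := hv.hasSum_inner x' x
  have hb := hw.hasSum_inner y' y
  simp only [mul_mul_mul_comm _ _ (inner ℂ (v _) x)] at h1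
  exact (ha.mul hb h1.summable).unique h1

end IsMixture

theorem HasTrace.unique {H : Type u} [NormedAddCommGroup H] [InnerProductSpace ℂ H]
    [CompleteSpace H] {T : H →L[ℂ] H} {c d : ℂ} (hc : HasTrace T c) (hd : HasTrace T d) : c = d := by
  obtain ⟨s, b, -⟩ := exists_hilbertBasis ℂ H
  exact (hc s b).unique (hd s b)

/-- Every state is a mixture: for a Hilbert basis `b`, take the vectors `√ρ bᵢ`. -/
theorem IsQuantumState.exists_isMixture {H : Type u} [NormedAddCommGroup H] [InnerProductSpace ℂ H]
    [CompleteSpace H] {ρ : H →L[ℂ] H} (h : IsQuantumState ρ) :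
    ∃ (ι : Type u) (v : ι → H), IsMixture ρ v := by
  obtain ⟨s, b, -⟩ := exists_hilbertBasis ℂ H
  have hρ := (ContinuousLinearMap.nonneg_iff_isPositive ρ).2 h.1
  have hr : ∀ x y, inner ℂ (CFC.sqrt ρ x) y = inner ℂ x (CFC.sqrt ρ y) := fun x y => by
    have h : IsSelfAdjoint (CFC.sqrt ρ) := (CFC.sqrt_nonneg ρ).isSelfAdjoint
    rw [← ContinuousLinearMap.adjoint_inner_left, h.adjoint_eq]
  have hrr : ∀ x, CFC.sqrt ρ (CFC.sqrt ρ x) = ρ x := fun x =>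
    DFunLike.congr_fun (CFC.sqrt_mul_sqrt_self ρ hρ) x
  have hs : Summable fun i => ‖CFC.sqrt ρ (b i)‖ ^ 2 := by
    convert (Complex.hasSum_re (h.2 s b)).summable using 1
    ext i
    rw [← hrr, ← hr, inner_self_eq_norm_sq_to_K]
    norm_cast
  have hm : IsMixture (∑' i, _) fun i => CFC.sqrt ρ (b i) := ⟨hs, (summable_rankOne hs).hasSum⟩
  refine ⟨s, fun i => CFC.sqrt ρ (b i), ?_⟩
  convert hm using 1
  ext y
  refine ext_inner_left ℂ fun x => ?_
  refine HasSum.unique ?_ (hm.hasSum_inner x y)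
  simpa only [hr, hrr] using b.hasSum_inner_mul_inner (CFC.sqrt ρ x) (CFC.sqrt ρ y)

theorem IsMixture.isQuantumState_iff {H : Type u} [NormedAddCommGroup H] [InnerProductSpace ℂ H]
    [CompleteSpace H] {ρ : H →L[ℂ] H} {v : ι → H} (h : IsMixture ρ v) :
    IsQuantumState ρ ↔ ∑' i, ‖v i‖ ^ 2 = 1 := by
  have h1 := h.hasTrace_comp 1
  have h2 : ∑' i, inner ℂ (v i) ((1 : H →L[ℂ] H) (v i)) = ((∑' i, ‖v i‖ ^ 2 : ℝ) : ℂ) := by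
    rw [Complex.ofReal_tsum]
    simp
  rw [h2] at h1
  refine ⟨fun hρ => ?_, fun hv => ⟨h.isPositive, ?_⟩⟩
  · exact_mod_cast h1.unique hρ.2
  · rw [hv] at h1
    exact_mod_cast h1

end Mixtures

/-! ### Partial traces -/

section Slice

variable {ι : Type*} {P H G : Type*}
  [NormedAddCommGroup P] [InnerProductSpace ℂ P]
  [NormedAddCommGroup H] [InnerProductSpace ℂ H] [CompleteSpace H]
  [NormedAddCommGroup G] [InnerProductSpace ℂ G] [CompleteSpace G]

/-- The operator `∑ᵢ (J vᵢ)† F (J vᵢ)` on `H`. When `G` is `P ⊗ H`, with `J v` tensoring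
by `v`, and `ρ` is the mixture of the `vᵢ`, this is the partial trace over `P` of `(ρ ⊗ 1) F`. -/
def slice (J : P →L[ℂ] H →L[ℂ] G) (v : ι → P) (F : G →L[ℂ] G) : H →L[ℂ] H :=
  ∑' i, (J (v i)).adjoint ∘L F ∘L J (v i)

variable {J : P →L[ℂ] H →L[ℂ] G} {v : ι → P}

theorem hasSum_slice (hv : Summable fun i => ‖v i‖ ^ 2) (F : G →L[ℂ] G) :
    HasSum (fun i => (J (v i)).adjoint ∘L F ∘L J (v i)) (slice J v F) := by
  refine (Summable.of_norm_bounded (hv.mul_left (‖J‖ ^ 2 * ‖F‖)) fun i => ?_).hasSum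
  calc _ ≤ ‖(J (v i)).adjoint‖ * (‖F‖ * ‖J (v i)‖) :=
        (ContinuousLinearMap.opNorm_comp_le _ _).trans
          (mul_le_mul_of_nonneg_left (ContinuousLinearMap.opNorm_comp_le _ _) (norm_nonneg _))
    _ = ‖F‖ * ‖J (v i)‖ ^ 2 := by rw [LinearIsometryEquiv.norm_map]; ring
    _ ≤ ‖F‖ * (‖J‖ * ‖v i‖) ^ 2 := by gcongr; exact J.le_opNorm _
    _ = _ := by ring

theorem isPositive_slice (hv : Summable fun i => ‖v i‖ ^ 2) {F : G →L[ℂ] G} (hF : F.IsPositive) :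
    (slice J v F).IsPositive := by
  rw [← ContinuousLinearMap.nonneg_iff_isPositive]
  refine (hasSum_slice hv F).nonneg fun i => ?_
  rw [ContinuousLinearMap.nonneg_iff_isPositive]
  exact hF.adjoint_conj _

theorem sum_slice {A : Type*} [Fintype A] (hv : Summable fun i => ‖v i‖ ^ 2)
    (F : A → G →L[ℂ] G) : ∑ a, slice J v (F a) = slice J v (∑ a, F a) := by
  refine (hasSum_sum fun a _ => hasSum_slice hv (F a)).unique ?_
  convert hasSum_slice (J := J) hv (∑ a, F a) using 2 with i
  ext h
  simp

theorem adjoint_comp_of_inner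
    (hJ : ∀ v v' h h', inner ℂ (J v h) (J v' h') = inner ℂ v v' * inner ℂ h h') (v v' : P) :
    (J v).adjoint ∘L J v' = (inner ℂ v v' : ℂ) • 1 := by
  ext h'
  refine ext_inner_left ℂ fun h => ?_
  simp [ContinuousLinearMap.adjoint_inner_right, hJ, inner_smul_right]

/-- An effect acting on the sliced system alone contributes a scalar. -/
theorem slice_eq_smul_one (hv : Summable fun i => ‖v i‖ ^ 2)
    (hJ : ∀ v v' h h', inner ℂ (J v h) (J v' h') = inner ℂ v v' * inner ℂ h h')
    {F : G →L[ℂ] G} {S : P →L[ℂ] P} (hF : ∀ v, F ∘L J v = J (S v)) :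
    slice J v F = (∑' i, inner ℂ (v i) (S (v i)) : ℂ) • 1 := by
  have h := hasSum_slice (J := J) hv F
  simp only [hF, adjoint_comp_of_inner hJ] at h
  refine h.unique (HasSum.smul_const ?_ _)
  refine (Summable.of_norm_bounded (hv.mul_left ‖S‖) fun i => ?_).hasSum
  calc _ ≤ ‖v i‖ * ‖S (v i)‖ := norm_inner_le_norm _ _
    _ ≤ ‖v i‖ * (‖S‖ * ‖v i‖) := by gcongr; exact S.le_opNorm _
    _ = _ := by ring

end Slice

/-! ### Tensoring with a vector of a source -/

namespace HilbertTensor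

variable {P Q R : Type*}
  [NormedAddCommGroup P] [InnerProductSpace ℂ P]
  [NormedAddCommGroup Q] [InnerProductSpace ℂ Q]
  [NormedAddCommGroup R] [InnerProductSpace ℂ R]

variable (P Q R) in
/-- For `v` in `P ⊗ Q`, the operator `r ↦ v ⊗ r` from `R` to `P ⊗ (Q ⊗ R)`. -/
def tensorLeft : P ⊗ₕ Q →L[ℂ] R →L[ℂ] P ⊗ₕ (Q ⊗ₕ R) :=
  ContinuousLinearMap.compL ℂ R ((P ⊗ₕ Q) ⊗ₕ R) (P ⊗ₕ (Q ⊗ₕ R))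
    (assoc P Q R : (P ⊗ₕ Q) ⊗ₕ R →L[ℂ] P ⊗ₕ (Q ⊗ₕ R)) ∘L tmulCLM (P ⊗ₕ Q) R

variable (P Q R) in
/-- For `u` in `Q ⊗ R`, the operator `p ↦ p ⊗ u` from `P` to `(P ⊗ Q) ⊗ R`. -/
def tensorRight : Q ⊗ₕ R →L[ℂ] P →L[ℂ] (P ⊗ₕ Q) ⊗ₕ R :=
  ContinuousLinearMap.compL ℂ P (P ⊗ₕ (Q ⊗ₕ R)) ((P ⊗ₕ Q) ⊗ₕ R)
    ((assoc P Q R).symm : P ⊗ₕ (Q ⊗ₕ R) →L[ℂ] (P ⊗ₕ Q) ⊗ₕ R) ∘L (tmulCLM P (Q ⊗ₕ R)).flip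

theorem tensorLeft_apply (v : P ⊗ₕ Q) (r : R) : tensorLeft P Q R v r = assoc P Q R (tmul v r) := rfl

theorem tensorRight_apply (u : Q ⊗ₕ R) (p : P) :
    tensorRight P Q R u p = (assoc P Q R).symm (tmul p u) := rfl

theorem tensorLeft_tmul (p : P) (q : Q) (r : R) :
    tensorLeft P Q R (tmul p q) r = tmul p (tmul q r) := by
  rw [tensorLeft_apply, assoc_tmul]

theorem tensorRight_tmul (p : P) (q : Q) (r : R) :
    tensorRight P Q R (tmul q r) p = tmul (tmul p q) r := by
  rw [tensorRight_apply, LinearIsometryEquiv.symm_apply_eq, assoc_tmul]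

theorem inner_tensorLeft (v v' : P ⊗ₕ Q) (r r' : R) :
    inner ℂ (tensorLeft P Q R v r) (tensorLeft P Q R v' r') = inner ℂ v v' * inner ℂ r r' := by
  rw [tensorLeft_apply, tensorLeft_apply, LinearIsometryEquiv.inner_map_map, inner_tmul_tmul]

theorem inner_tensorRight (u u' : Q ⊗ₕ R) (p p' : P) :
    inner ℂ (tensorRight P Q R u p) (tensorRight P Q R u' p') = inner ℂ u u' * inner ℂ p p' := by
  rw [tensorRight_apply, tensorRight_apply, LinearIsometryEquiv.inner_map_map, inner_tmul_tmul,
    mul_comm]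

theorem map_map_assoc (S : P →L[ℂ] P) (T : Q →L[ℂ] Q) (U : R →L[ℂ] R) (z : (P ⊗ₕ Q) ⊗ₕ R) :
    map S (map T U) (assoc P Q R z) = assoc P Q R (map (map S T) U z) := by
  let α : (P ⊗ₕ Q) ⊗ₕ R →L[ℂ] P ⊗ₕ (Q ⊗ₕ R) := assoc P Q R
  have h : map S (map T U) ∘L α = α ∘L map (map S T) U := by
    refine clm_ext fun v r => ?_
    have h' : (map S (map T U) ∘L α) ∘L (tmulCLM _ R).flip r
        = (α ∘L map (map S T) U) ∘L (tmulCLM _ R).flip r :=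
      clm_ext fun p q => by simp [α, assoc_tmul, map_tmul]
    exact DFunLike.congr_fun h' v
  exact DFunLike.congr_fun h z

theorem map_one_comp_tensorLeft (S : P →L[ℂ] P) (v : P ⊗ₕ Q) :
    map S (1 : Q ⊗ₕ R →L[ℂ] Q ⊗ₕ R) ∘L tensorLeft P Q R v =
      tensorLeft P Q R (map S (1 : Q →L[ℂ] Q) v) := by
  ext r
  rw [ContinuousLinearMap.comp_apply, tensorLeft_apply, tensorLeft_apply, ← map_one_one, map_map_assoc,
    map_tmul, one_apply_eq_self]

theorem map_one_comp_tensorRight (S : R →L[ℂ] R) (u : Q ⊗ₕ R) :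
    map (1 : P ⊗ₕ Q →L[ℂ] P ⊗ₕ Q) S ∘L tensorRight P Q R u =
      tensorRight P Q R (map (1 : Q →L[ℂ] Q) S u) := by
  ext p
  rw [ContinuousLinearMap.comp_apply, tensorRight_apply, tensorRight_apply, ← map_one_one,
    LinearIsometryEquiv.eq_symm_apply, ← map_map_assoc, LinearIsometryEquiv.apply_symm_apply,
    map_tmul, one_apply_eq_self]

end HilbertTensor

open HilbertTensor

/-! ### The trace formula for the path scenario -/

namespace P4.QuantumModel

variable {X A B Y : Type*} [Fintype X] [Fintype A] [Fintype B] [Fintype Y]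
  (M : QuantumModel.{u} X A B Y) {ι κ μ : Type*}

/-- On a product `v ⊗ (w ⊗ z)` of arbitrary, possibly entangled, source vectors the regrouping attaches
`v` and `z` to the two sides of `w`. -/
theorem regroup_tmul_tmul (v : M.HXA ⊗ₕ M.HAX) (w : M.HAB ⊗ₕ M.HBA) (z : M.HBY ⊗ₕ M.HYB) :
    M.regroup (tmul v (tmul w z)) =
      assoc M.HXA (M.HAX ⊗ₕ M.HAB) ((M.HBA ⊗ₕ M.HBY) ⊗ₕ M.HYB)
        (map (tensorLeft M.HXA M.HAX M.HAB v) (tensorRight M.HBA M.HBY M.HYB z) w) := by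
  let ρ : M.SourceSpace →L[ℂ] M.PartySpace := M.regroup
  let α : (M.HXA ⊗ₕ (M.HAX ⊗ₕ M.HAB)) ⊗ₕ ((M.HBA ⊗ₕ M.HBY) ⊗ₕ M.HYB) →L[ℂ] M.PartySpace :=
    assoc M.HXA (M.HAX ⊗ₕ M.HAB) ((M.HBA ⊗ₕ M.HBY) ⊗ₕ M.HYB)
  -- both sides are bounded and linear in each of `w`, `v` and `z`
  have hw : ρ ∘L tmulCLM _ _ v ∘L (tmulCLM _ _).flip z = α ∘L
      map (tensorLeft M.HXA M.HAX M.HAB v) (tensorRight M.HBA M.HBY M.HYB z) := by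
    refine clm_ext fun a₂ b₁ => ?_
    have hv : ρ ∘L (tmulCLM _ _).flip (tmul (tmul a₂ b₁) z) = α ∘L
        (tmulCLM _ _).flip (tensorRight M.HBA M.HBY M.HYB z b₁) ∘L
          (tensorLeft M.HXA M.HAX M.HAB).flip a₂ := by
      refine clm_ext fun x a₁ => ?_
      have hz : ρ ∘L tmulCLM _ _ (tmul x a₁) ∘L tmulCLM _ _ (tmul a₂ b₁) = α ∘L
          tmulCLM _ _ (tensorLeft M.HXA M.HAX M.HAB (tmul x a₁) a₂) ∘L
            (tensorRight M.HBA M.HBY M.HYB).flip b₁ := by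
        refine clm_ext fun b₂ y => ?_
        simp only [ContinuousLinearMap.comp_apply, ContinuousLinearMap.flip_apply, tmulCLM_apply,
          tensorLeft_tmul, tensorRight_tmul]
        exact (M.regroup_tmul x a₁ a₂ b₁ b₂ y).trans (assoc_tmul _ _ _).symm
      exact DFunLike.congr_fun hz z
    have := DFunLike.congr_fun hv v
    simpa [map_tmul] using this
  exact DFunLike.congr_fun hw w

theorem inner_effectOnSources (v : M.HXA ⊗ₕ M.HAX) (w : M.HAB ⊗ₕ M.HBA) (z : M.HBY ⊗ₕ M.HYB)
    (x : X) (a : A) (b : B) (y : Y) :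
    inner ℂ (tmul v (tmul w z)) (M.effectOnSources x a b y (tmul v (tmul w z))) =
      inner ℂ w (map
        ((tensorLeft M.HXA M.HAX M.HAB v).adjoint ∘L map (M.EX x) (M.EA a) ∘L
          tensorLeft M.HXA M.HAX M.HAB v)
        ((tensorRight M.HBA M.HBY M.HYB z).adjoint ∘L map (M.EB b) (M.EY y) ∘L
          tensorRight M.HBA M.HBY M.HYB z) w) := by
  have h1 : inner ℂ (tmul v (tmul w z)) (M.effectOnSources x a b y (tmul v (tmul w z))) =
      inner ℂ (M.regroup (tmul v (tmul w z)))
        (M.effect x a b y (M.regroup (tmul v (tmul w z)))) := by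
    rw [← LinearIsometryEquiv.inner_map_map M.regroup]
    simp [effectOnSources]
  rw [h1, regroup_tmul_tmul, effect, map_map_assoc, LinearIsometryEquiv.inner_map_map, map_comp,
    map_comp, ← adjoint_map, ContinuousLinearMap.comp_apply,
    ContinuousLinearMap.adjoint_inner_right, ContinuousLinearMap.comp_apply]

variable {M}

/-- The probability of the network is `tr (ρ_AB (S ⊗ T))`, where `S` and `T` are the partial traces of
the effects of `X`, `A` and of `B`, `Y` over the outer sources. -/
theorem hasTrace_state_comp {v : ι → M.HXA ⊗ₕ M.HAX} {w : κ → M.HAB ⊗ₕ M.HBA}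
    {z : μ → M.HBY ⊗ₕ M.HYB} (hv : IsMixture M.ρXA v) (hw : IsMixture M.ρAB w)
    (hz : IsMixture M.ρBY z) (x : X) (a : A) (b : B) (y : Y) :
    HasTrace (M.state ∘L M.effectOnSources x a b y)
      (∑' j, inner ℂ (w j) (map
        (slice (tensorLeft M.HXA M.HAX M.HAB) v (map (M.EX x) (M.EA a)))
        (slice (tensorRight M.HBA M.HBY M.HYB) z (map (M.EB b) (M.EY y))) (w j))) := by
  have hm : IsMixture M.state _ := hv.map (hw.map hz)
  convert hm.hasTrace_comp (M.effectOnSources x a b y) using 1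
  have hs := hm.summable_inner (M.effectOnSources x a b y)
  let e : κ × ι × μ ≃ ι × κ × μ :=
    ⟨fun q => (q.2.1, q.1, q.2.2), fun q => (q.2.1, q.1, q.2.2), fun _ => rfl, fun _ => rfl⟩
  have hs' := e.summable_iff.mpr hs
  have ht := e.hasSum_iff.mpr hs.hasSum
  -- for a fixed vector `w j` of the middle source, sum over `k` and then over `i`
  refine (ht.prod_fiberwise fun j => ?_).tsum_eq
  have hj := hs'.prod_factor j
  let L : ((M.HAB →L[ℂ] M.HAB) →L[ℂ] (M.HBA →L[ℂ] M.HBA) →L[ℂ] ℂ) :=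
    (ContinuousLinearMap.compL ℂ _ _ _ (innerSL ℂ (w j) ∘L ContinuousLinearMap.apply ℂ _ (w j))) ∘L
      mapCLM M.HAB M.HBA M.HAB M.HBA
  have hL : ∀ S T, L S T = inner ℂ (w j) (map S T (w j)) := fun S T => rfl
  have h2 := hj.hasSum.prod_fiberwise fun i => by
    simp only [Function.comp_apply, e, Equiv.coe_fn_mk, inner_effectOnSources, ← hL]
    exact (L _).hasSum (hasSum_slice hz.summable (map (M.EB b) (M.EY y)))
  have h3 := (L.flip (slice (tensorRight M.HBA M.HBY M.HYB) z (map (M.EB b) (M.EY y)))).hasSum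
    (hasSum_slice (J := tensorLeft M.HXA M.HAX M.HAB) hv.summable (map (M.EX x) (M.EA a)))
  have h4 := h2.unique h3
  rw [ContinuousLinearMap.flip_apply] at h4
  rw [← hL, ← h4]
  exact hj.hasSum

end P4.QuantumModel

open HilbertTensor InnerProductSpace

theorem HasTrace.smul {H : Type u} [NormedAddCommGroup H] [InnerProductSpace ℂ H]
    [CompleteSpace H] {T : H →L[ℂ] H} {t : ℂ} (h : HasTrace T t) (c : ℂ) :
    HasTrace (c • T) (c * t) := fun ι b => by
  simpa [inner_smul_right] using (h ι b).mul_left c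

theorem HasTrace.sum {α : Type*} {H : Type u} [NormedAddCommGroup H] [InnerProductSpace ℂ H]
    [CompleteSpace H] {s : Finset α} {T : α → H →L[ℂ] H} {t : α → ℂ}
    (h : ∀ a, HasTrace (T a) (t a)) : HasTrace (∑ a ∈ s, T a) (∑ a ∈ s, t a) := fun ι b => by
  simpa [inner_sum] using hasSum_sum fun a (_ : a ∈ s) => h a ι b

/-! ### Marginals of a correlation -/

namespace P4

/-- A factorization `p(x, y) = c(x) d(y)` is the one into marginals as soon as one factor is normalized.
The factors are complex because they arise as traces. -/
theorem eq_margX_of_margXY_eq_mul {X A B Y : Type*} [Fintype A] [Fintype B] [Fintype Y]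
    {p : X → A → B → Y → ℝ} {c : X → ℂ} {d : Y → ℂ}
    (h : ∀ x y, (margXY p x y : ℂ) = c x * d y) (hd : ∑ y, d y = 1) (x : X) : c x = margX p x := by
  have h1 : margX p x = ∑ y, margXY p x y := by
    simp only [margX, margXY]
    rw [Finset.sum_comm]
    conv_lhs => enter [2, b]; rw [Finset.sum_comm]
    rw [Finset.sum_comm]
    exact Finset.sum_congr rfl fun y _ => Finset.sum_comm
  rw [h1]
  push_cast
  simp only [h, ← Finset.mul_sum, hd, mul_one]

theorem eq_margY_of_margXY_eq_mul {X A B Y : Type*} [Fintype X] [Fintype A] [Fintype B]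
    {p : X → A → B → Y → ℝ} {c : X → ℂ} {d : Y → ℂ}
    (h : ∀ x y, (margXY p x y : ℂ) = c x * d y) (hc : ∑ x, c x = 1) (y : Y) : d y = margY p y := by
  have h1 : margY p y = ∑ x, margXY p x y := rfl
  rw [h1]
  push_cast
  simp only [h, ← Finset.sum_mul, hc, one_mul]

variable {X A B Y : Type*} [Fintype X] [Fintype A] [Fintype B] [Fintype Y]
  {p : X → A → B → Y → ℝ}

namespace IsCorrelation

theorem sum_margY (hp : IsCorrelation p) : ∑ y, margY p y = 1 := by
  rw [← hp.sum_eq_one]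
  simp only [margY]
  rw [Finset.sum_comm]
  refine Finset.sum_congr rfl fun x _ => ?_
  rw [Finset.sum_comm]
  exact Finset.sum_congr rfl fun a _ => Finset.sum_comm

theorem sum_margX (hp : IsCorrelation p) : ∑ x, margX p x = 1 := hp.sum_eq_one

theorem margXY_eq (hp : IsCorrelation p) (x : X) (y : Y) :
    margXY p x y = margX p x * margY p y := by
  have h : ∀ a, ∑ b, p x a b y = margXA p x a * margY p y := fun a => hp.indep_y x a y
  simp only [margXY, h, ← Finset.sum_mul]
  rfl

end IsCorrelation

/-! ### From a quantum network to a quantum Bell scenario -/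

namespace QuantumModel

variable {M : QuantumModel.{u} X A B Y} {ι κ μ : Type*} {v : ι → M.HXA ⊗ₕ M.HAX}
  {w : κ → M.HAB ⊗ₕ M.HBA} {z : μ → M.HBY ⊗ₕ M.HYB}

theorem sum_slice_left (hv : IsMixture M.ρXA v) (x : X) :
    ∑ a, slice (tensorLeft M.HXA M.HAX M.HAB) v (map (M.EX x) (M.EA a)) =
      (∑' i, inner ℂ (v i) (map (M.EX x) 1 (v i)) : ℂ) • 1 := by
  have h : ∑ a, map (M.EX x) (M.EA a) = map (M.EX x) 1 := by
    simp only [← mapCLM_apply, ← map_sum, M.povmA.2]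
  rw [sum_slice hv.summable, h]
  exact slice_eq_smul_one hv.summable inner_tensorLeft (map_one_comp_tensorLeft _)

theorem sum_slice_right (hz : IsMixture M.ρBY z) (y : Y) :
    ∑ b, slice (tensorRight M.HBA M.HBY M.HYB) z (map (M.EB b) (M.EY y)) =
      (∑' i, inner ℂ (z i) (map 1 (M.EY y) (z i)) : ℂ) • 1 := by
  have h : ∑ b, map (M.EB b) (M.EY y) = map 1 (M.EY y) := by
    simp only [← mapCLM_apply, ← _root_.sum_apply, ← map_sum, M.povmB.2]
  rw [sum_slice hz.summable, h]
  exact slice_eq_smul_one hz.summable inner_tensorRight (map_one_comp_tensorRight _)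

theorem sum_tsum_left (hv : IsMixture M.ρXA v) :
    ∑ x, (∑' i, inner ℂ (v i) (map (M.EX x) 1 (v i)) : ℂ) = 1 := by
  refine (HasTrace.unique ?_ M.stateXA.2)
  have h : M.ρXA = ∑ x, M.ρXA ∘L map (M.EX x) 1 := by
    have h : ∑ x, map (M.EX x) (1 : M.HAX →L[ℂ] M.HAX) = 1 := by
      simp only [← mapCLM_apply, ← _root_.sum_apply, ← map_sum, M.povmX.2]
      exact map_one_one
    rw [← ContinuousLinearMap.comp_finsetSum, h]
    rfl
  rw [h]
  exact HasTrace.sum fun x => hv.hasTrace_comp _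

theorem sum_tsum_right (hz : IsMixture M.ρBY z) :
    ∑ y, (∑' i, inner ℂ (z i) (map 1 (M.EY y) (z i)) : ℂ) = 1 := by
  refine (HasTrace.unique ?_ M.stateBY.2)
  have h : M.ρBY = ∑ y, M.ρBY ∘L map 1 (M.EY y) := by
    have h : ∑ y, map (1 : M.HBY →L[ℂ] M.HBY) (M.EY y) = 1 := by
      simp only [← mapCLM_apply, ← map_sum, M.povmY.2]
      exact map_one_one
    rw [← ContinuousLinearMap.comp_finsetSum, h]
    rfl
  rw [h]
  exact HasTrace.sum fun x => hz.hasTrace_comp _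

/-- If the `P₄` correlation is quantum, then measuring `x` and `y` prepares states next to the source
in the middle, and together with the joint measurements of `A` and `B` these give local POVMs. -/
theorem isQuantum_cond (M : QuantumModel.{u} X A B Y) (hp : IsCorrelation p)
    (hx : ∀ x, 0 < margX p x) (hy : ∀ y, 0 < margY p y)
    (hM : ∀ x a b y, HasTrace (M.state ∘L M.effectOnSources x a b y) (p x a b y : ℂ)) :
    Bell.IsQuantum.{u} (cond p) := by
  obtain ⟨ι, v, hv⟩ := M.stateXA.exists_isMixture
  obtain ⟨κ, w, hw⟩ := M.stateAB.exists_isMixture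
  obtain ⟨μ, z, hz⟩ := M.stateBY.exists_isMixture
  set E := fun x a => slice (tensorLeft M.HXA M.HAX M.HAB) v (map (M.EX x) (M.EA a)) with hE
  set F := fun y b => slice (tensorRight M.HBA M.HBY M.HYB) z (map (M.EB b) (M.EY y)) with hF
  have htr : ∀ x y a b, HasTrace (M.ρAB ∘L map (E x a) (F y b)) (p x a b y : ℂ) :=
    fun x y a b => by
      rw [(hM x a b y).unique (hasTrace_state_comp hv hw hz x a b y)]
      exact hw.hasTrace_comp _
  set c : X → ℂ := fun x => ∑' i, inner ℂ (v i) (map (M.EX x) 1 (v i)) with hc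
  set d : Y → ℂ := fun y => ∑' i, inner ℂ (z i) (map 1 (M.EY y) (z i)) with hd
  have hEc : ∀ x, ∑ a, E x a = c x • 1 := sum_slice_left hv
  have hFd : ∀ y, ∑ b, F y b = d y • 1 := sum_slice_right hz
  -- summing over `a` and `b` replaces both slices by scalars and leaves `tr ρ_AB = 1`
  have hcd : ∀ x y, (margXY p x y : ℂ) = c x * d y := fun x y => by
    have h1 : HasTrace (M.ρAB ∘L map (∑ a, E x a) (∑ b, F y b)) (margXY p x y : ℂ) := by
      have h : M.ρAB ∘L map (∑ a, E x a) (∑ b, F y b) =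
          ∑ a, ∑ b, M.ρAB ∘L map (E x a) (F y b) := by
        simp only [← ContinuousLinearMap.comp_finsetSum, ← mapCLM_apply, map_sum,
          _root_.sum_apply]
        rw [Finset.sum_comm]
      rw [h, margXY]
      push_cast
      exact HasTrace.sum fun a => HasTrace.sum fun b => htr x y a b
    refine h1.unique ?_
    have h : M.ρAB ∘L map (∑ a, E x a) (∑ b, F y b) = (c x * d y) • M.ρAB := by
      rw [hEc, hFd]
      rw [map_smul_smul, map_one_one, ContinuousLinearMap.comp_smul]
      rfl
    rw [h]
    simpa using M.stateAB.2.smul (c x * d y)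
  have hc' : ∀ x, c x = margX p x := eq_margX_of_margXY_eq_mul hcd (sum_tsum_right hz)
  have hd' : ∀ y, d y = margY p y := eq_margY_of_margXY_eq_mul hcd (sum_tsum_left hv)
  have hxc : ∀ x, (margX p x : ℂ) ≠ 0 := fun x => by exact_mod_cast (hx x).ne'
  have hyc : ∀ y, (margY p y : ℂ) ≠ 0 := fun y => by exact_mod_cast (hy y).ne'
  refine ⟨M.HAB, M.HBA, M.ρAB, fun x a => ((margX p x)⁻¹ : ℂ) • E x a,
    fun y b => ((margY p y)⁻¹ : ℂ) • F y b, M.stateAB, fun x => ⟨fun a => ?_, ?_⟩,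
    fun y => ⟨fun b => ?_, ?_⟩, fun x y a b => ?_⟩
  · refine (isPositive_slice hv.summable
      (isPositive_map (M.povmX.1 x) (M.povmA.1 a))).smul_of_nonneg ?_
    exact_mod_cast (inv_pos.2 (hx x)).le
  · rw [← Finset.smul_sum, hEc, hc', smul_smul, inv_mul_cancel₀ (hxc x), one_smul]
  · refine (isPositive_slice hz.summable
      (isPositive_map (M.povmB.1 b) (M.povmY.1 y))).smul_of_nonneg ?_
    exact_mod_cast (inv_pos.2 (hy y)).le
  · rw [← Finset.smul_sum, hFd, hd', smul_smul, inv_mul_cancel₀ (hyc y), one_smul]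
  · have h : M.ρAB ∘L map (((margX p x)⁻¹ : ℂ) • E x a) (((margY p y)⁻¹ : ℂ) • F y b) =
        ((margX p x : ℂ)⁻¹ * (margY p y : ℂ)⁻¹) • (M.ρAB ∘L map (E x a) (F y b)) := by
      rw [map_smul_smul, ContinuousLinearMap.comp_smul]
    rw [h, cond, hp.margXY_eq]
    convert (htr x y a b).smul _ using 1
    push_cast
    rw [div_eq_inv_mul, mul_inv]

end QuantumModel

/-! ### From a quantum Bell scenario to a quantum network -/

section Preparation

theorem _root_.isPOVM_rankOne {L : Type*} [NormedAddCommGroup L]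
    [InnerProductSpace ℂ L] [CompleteSpace L] (e : OrthonormalBasis X ℂ L) :
    IsPOVM fun x => rankOne ℂ (e x) (e x) :=
  ⟨fun _ => isPositive_rankOne_self _, e.sum_rankOne_eq_id⟩

variable (X) in
/-- Coordinates are indexed by a copy of `X` in the universe of the Hilbert space. -/
theorem exists_orthonormalBasis : ∃ L : HilbertSpaceBundle.{u}, Nonempty (OrthonormalBasis X ℂ L) :=
  ⟨⟨EuclideanSpace ℂ (ULift.{u} (Fin (Fintype.card X)))⟩,
    ⟨(EuclideanSpace.basisFun _ ℂ).reindex (Equiv.ulift.trans (Fintype.equivFin X).symm)⟩⟩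

variable {A : Type*} {L H : Type u} [NormedAddCommGroup L] [InnerProductSpace ℂ L]
  [NormedAddCommGroup H] [InnerProductSpace ℂ H] [CompleteSpace H]
  (e : OrthonormalBasis X ℂ L) {q : X → ℝ} {E : X → A → H →L[ℂ] H}

/-- The unnormalized vectors `√q(x) (eₓ ⊗ eₓ)`; their mixture is a source that sends a copy of `x`,
distributed according to `q`, to both of its parties. -/
def copyVec (q : X → ℝ) (x : X) : L ⊗ₕ L := (Real.sqrt (q x) : ℂ) • tmul (e x) (e x)

/-- The classically correlated state `∑ₓ q(x) |eₓ eₓ⟩⟨eₓ eₓ|`. -/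
def copyState (q : X → ℝ) : L ⊗ₕ L →L[ℂ] L ⊗ₕ L :=
  ∑ x, rankOne ℂ (copyVec e q x) (copyVec e q x)

theorem isMixture_copyState : IsMixture (copyState e q) (copyVec e q) :=
  ⟨(hasSum_fintype _).summable, hasSum_fintype _⟩

theorem norm_copyVec_sq {x : X} (hq : 0 ≤ q x) : ‖copyVec e q x‖ ^ 2 = q x := by
  simp [copyVec, norm_smul, norm_tmul, Real.sq_sqrt hq]

theorem isQuantumState_copyState (hq : ∀ x, 0 ≤ q x) (h1 : ∑ x, q x = 1) :
    IsQuantumState (copyState e q) := by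
  rw [(isMixture_copyState e).isQuantumState_iff, tsum_fintype]
  simpa only [norm_copyVec_sq e (hq _)] using h1

/-- The measurement that reads off `x` from the left factor and then performs `E x` on the right. -/
def readLeft (E : X → A → H →L[ℂ] H) (a : A) : L ⊗ₕ H →L[ℂ] L ⊗ₕ H :=
  ∑ x, map (rankOne ℂ (e x) (e x)) (E x a)

/-- The measurement that reads off `x` from the right factor and then performs `E x` on the left. -/
def readRight (E : X → A → H →L[ℂ] H) (a : A) : H ⊗ₕ L →L[ℂ] H ⊗ₕ L :=
  ∑ x, map (E x a) (rankOne ℂ (e x) (e x))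

/-- Measuring one copy in the basis `e` and reading off the other prepares the effect `E x` with weight
`q x`: only the vector `eₓ ⊗ eₓ` of the source contributes. -/
theorem slice_readLeft (hq : ∀ x, 0 ≤ q x) (x : X) (a : A) :
    slice (tensorLeft L L H) (copyVec e q) (map (rankOne ℂ (e x) (e x)) (readLeft e E a)) =
      (q x : ℂ) • E x a := by
  classical
  have h : ∀ x', map (rankOne ℂ (e x) (e x)) (readLeft e E a) ∘L
      tensorLeft L L H (copyVec e q x') =
        if x' = x then tensorLeft L L H (copyVec e q x') ∘L E x' a else 0 := by
    intro x'
    ext t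
    have h1 : readLeft e E a (tmul (e x') t) = tmul (e x') (E x' a t) := by
      simp only [readLeft, _root_.sum_apply, map_tmul, rankOne_apply,
        e.inner_eq_ite, ite_smul, one_smul, zero_smul]
      rw [Finset.sum_eq_single x' (fun z _ hz => by simp [hz]) (by simp)]
      simp
    split_ifs with hxx
    · subst hxx
      simp [copyVec, tensorLeft_tmul, map_tmul, h1]
    · simp [copyVec, tensorLeft_tmul, map_tmul, h1, e.inner_eq_ite, Ne.symm hxx]
  rw [slice, tsum_fintype]
  simp only [h]
  rw [Finset.sum_eq_single x (fun z _ hz => by simp [hz]) (by simp), if_pos rfl,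
    ← ContinuousLinearMap.comp_assoc, adjoint_comp_of_inner inner_tensorLeft,
    inner_self_eq_norm_sq_to_K]
  norm_cast
  rw [norm_copyVec_sq e (hq x)]
  rfl

theorem slice_readRight (hq : ∀ x, 0 ≤ q x) (x : X) (a : A) :
    slice (tensorRight H L L) (copyVec e q) (map (readRight e E a) (rankOne ℂ (e x) (e x))) =
      (q x : ℂ) • E x a := by
  classical
  have h : ∀ x', map (readRight e E a) (rankOne ℂ (e x) (e x)) ∘L
      tensorRight H L L (copyVec e q x') =
        if x' = x then tensorRight H L L (copyVec e q x') ∘L E x' a else 0 := by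
    intro x'
    ext t
    have h1 : readRight e E a (tmul t (e x')) = tmul (E x' a t) (e x') := by
      simp only [readRight, _root_.sum_apply, map_tmul, rankOne_apply,
        e.inner_eq_ite, ite_smul, one_smul, zero_smul]
      rw [Finset.sum_eq_single x' (fun z _ hz => by simp [hz]) (by simp)]
      simp
    split_ifs with hxx
    · subst hxx
      simp [copyVec, tensorRight_tmul, map_tmul, h1]
    · simp [copyVec, tensorRight_tmul, map_tmul, h1, e.inner_eq_ite, Ne.symm hxx]
  rw [slice, tsum_fintype]
  simp only [h]
  rw [Finset.sum_eq_single x (fun z _ hz => by simp [hz]) (by simp), if_pos rfl,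
    ← ContinuousLinearMap.comp_assoc, adjoint_comp_of_inner inner_tensorRight,
    inner_self_eq_norm_sq_to_K]
  norm_cast
  rw [norm_copyVec_sq e (hq x)]
  rfl

variable [CompleteSpace L] [Fintype A]

theorem isPOVM_readLeft (hE : ∀ x, IsPOVM (E x)) : IsPOVM (readLeft e E) := by
  refine ⟨fun a => ContinuousLinearMap.isPositive_sum _ fun x _ =>
    isPositive_map (isPositive_rankOne_self _) ((hE x).1 a), ?_⟩
  simp only [readLeft]
  rw [Finset.sum_comm]
  simp only [← mapCLM_apply, ← map_sum, (hE _).2, ← _root_.sum_apply]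
  rw [(isPOVM_rankOne e).2]
  exact map_one_one

theorem isPOVM_readRight (hE : ∀ x, IsPOVM (E x)) : IsPOVM (readRight e E) := by
  refine ⟨fun a => ContinuousLinearMap.isPositive_sum _ fun x _ =>
    isPositive_map ((hE x).1 a) (isPositive_rankOne_self _), ?_⟩
  simp only [readRight]
  rw [Finset.sum_comm]
  simp only [← mapCLM_apply, ← map_sum, (hE _).2, ← _root_.sum_apply]
  rw [(isPOVM_rankOne e).2]
  exact map_one_one

end Preparation

/-- The outer sources distribute classical copies of `x` and `y`, which `A` and `B` use as settings. -/
theorem isQuantum_of_cond (hp : IsCorrelation p)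
    (hx : ∀ x, 0 < margX p x) (hy : ∀ y, 0 < margY p y)
    (h : Bell.IsQuantum.{u} (cond p)) : IsQuantum.{u} p := by
  obtain ⟨H, K, ρ, E, F, hρ, hE, hF, hEF⟩ := h
  obtain ⟨L, ⟨e⟩⟩ := exists_orthonormalBasis.{u} X
  obtain ⟨N, ⟨f⟩⟩ := exists_orthonormalBasis.{u} Y
  have hx' : ∀ x, 0 ≤ margX p x := fun x => (hx x).le
  have hy' : ∀ y, 0 ≤ margY p y := fun y => (hy y).le
  let M : QuantumModel.{u} X A B Y :=
    { HXA := L, HAX := L, HAB := H, HBA := K, HBY := N, HYB := N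
      ρXA := copyState e (margX p), ρAB := ρ, ρBY := copyState f (margY p)
      EX := fun x => rankOne ℂ (e x) (e x), EA := readLeft e E
      EB := readRight f F, EY := fun y => rankOne ℂ (f y) (f y)
      stateXA := isQuantumState_copyState e hx' hp.sum_margX
      stateAB := hρ
      stateBY := isQuantumState_copyState f hy' hp.sum_margY
      povmX := isPOVM_rankOne e
      povmA := isPOVM_readLeft e hE
      povmB := isPOVM_readRight f hF
      povmY := isPOVM_rankOne f }
  obtain ⟨κ, w, hw⟩ := hρ.exists_isMixture
  refine ⟨M, fun x a b y => ?_⟩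
  have h1 := QuantumModel.hasTrace_state_comp (M := M) (isMixture_copyState e) hw
    (isMixture_copyState f) x a b y
  have hl : slice (tensorLeft M.HXA M.HAX M.HAB) (copyVec e (margX p))
      (map (M.EX x) (M.EA a)) = (margX p x : ℂ) • E x a := slice_readLeft e hx' x a
  have hr : slice (tensorRight M.HBA M.HBY M.HYB) (copyVec f (margY p))
      (map (M.EB b) (M.EY y)) = (margY p y : ℂ) • F y b := slice_readRight f hy' y b
  rw [hl, hr] at h1
  have h2 : HasTrace (ρ ∘L map ((margX p x : ℂ) • E x a) ((margY p y : ℂ) • F y b))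
      (p x a b y : ℂ) := by
    have h : ρ ∘L map ((margX p x : ℂ) • E x a) ((margY p y : ℂ) • F y b) =
        (margX p x * margY p y : ℂ) • (ρ ∘L map (E x a) (F y b)) := by
      rw [map_smul_smul, ContinuousLinearMap.comp_smul]
    rw [h]
    convert (hEF x y a b).smul _ using 1
    rw [cond, hp.margXY_eq]
    have := (hx x).ne'
    have := (hy y).ne'
    norm_cast
    field_simp
  rwa [← h2.unique (hw.hasTrace_comp _)] at h1

end P4

/-! ### Conditional distributions -/

namespace IsConditionalDistribution

variable {Ω Ω' O : Type*} [MeasurableSpace Ω] [MeasurableSpace Ω'] [Fintype O] {μ : Measure Ω}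
  {ν : Measure Ω'} {f : O → Ω → ℝ}

theorem ae_le_one (hf : IsConditionalDistribution μ f) (o : O) : ∀ᵐ ω ∂μ, f o ω ≤ 1 := by
  filter_upwards [ae_all_iff.2 hf.2.1, hf.2.2] with ω h0 h1
  rw [← h1]
  exact Finset.single_le_sum (f := fun o => f o ω) (fun o _ => h0 o) (Finset.mem_univ o)

theorem comp (hf : IsConditionalDistribution μ f) {g : Ω' → Ω}
    (hg : Measure.QuasiMeasurePreserving g ν μ) :
    IsConditionalDistribution ν fun o ω => f o (g ω) :=
  ⟨fun o => (hf.1 o).comp_quasiMeasurePreserving hg, fun o => hg.ae (hf.2.1 o), hg.ae hf.2.2⟩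

theorem integrable [IsFiniteMeasure μ] (hf : IsConditionalDistribution μ f) (o : O) :
    Integrable (f o) μ := by
  refine Integrable.of_bound (hf.1 o).aestronglyMeasurable 1 ?_
  filter_upwards [hf.2.1 o, hf.ae_le_one o] with ω h0 h1
  rwa [Real.norm_of_nonneg h0]

theorem integrable_mul [IsFiniteMeasure μ] (hf : IsConditionalDistribution μ f) (o : O)
    {h : Ω → ℝ} (hh : Integrable h μ) : Integrable (fun ω => h ω * f o ω) μ := by
  refine hh.mul_bdd (c := 1) (hf.1 o).aestronglyMeasurable ?_
  filter_upwards [hf.2.1 o, hf.ae_le_one o] with ω h0 h1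
  rwa [Real.norm_of_nonneg h0]

theorem sum_integral [IsProbabilityMeasure μ] (hf : IsConditionalDistribution μ f) :
    ∑ o, ∫ ω, f o ω ∂μ = 1 := by
  rw [← integral_finsetSum _ fun o _ => hf.integrable o, integral_congr_ae hf.2.2]
  simp

end IsConditionalDistribution

namespace P4

/-! ### From a classical network to a local hidden variable -/

section Averaging

variable {Ω Ω' O A : Type*} [MeasurableSpace Ω] [MeasurableSpace Ω'] [Fintype O] [Fintype A]
  {μ : Measure Ω} {ν : Measure Ω'} [IsProbabilityMeasure μ] [IsProbabilityMeasure ν]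
  {h : O → Ω → ℝ} {f : A → Ω × Ω' → ℝ}

/-- The joint probability of the outcomes `o` and `a` given the hidden variable in `Ω'`, obtained by
averaging over the one in `Ω`. -/
def average (μ : Measure Ω) (h : O → Ω → ℝ) (f : A → Ω × Ω' → ℝ) (o : O) (a : A) (l : Ω') : ℝ :=
  ∫ k, h o k * f a (k, l) ∂μ

theorem integrable_mul_fst (hh : IsConditionalDistribution μ h)
    (hf : IsConditionalDistribution (μ.prod ν) f) (o : O) (a : A) :
    Integrable (fun q : Ω × Ω' => h o q.1 * f a q) (μ.prod ν) :=
  hf.integrable_mul a ((hh.comp Measure.quasiMeasurePreserving_fst).integrable o)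

theorem integrable_average (hh : IsConditionalDistribution μ h)
    (hf : IsConditionalDistribution (μ.prod ν) f) (o : O) (a : A) :
    Integrable (average μ h f o a) ν :=
  (integrable_mul_fst hh hf o a).integral_prod_right

theorem average_nonneg (hh : IsConditionalDistribution μ h)
    (hf : IsConditionalDistribution (μ.prod ν) f) (o : O) (a : A) :
    ∀ᵐ l ∂ν, 0 ≤ average μ h f o a l := by
  have h1 := Measure.ae_ae_of_ae_prod
    ((Measure.measurePreserving_swap (μ := ν) (ν := μ)).quasiMeasurePreserving.ae (hf.2.1 a))
  filter_upwards [h1] with l h1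
  refine integral_nonneg_of_ae ?_
  filter_upwards [h1, hh.2.1 o] with k hk hk'
  exact mul_nonneg hk' hk

/-- The response functions sum to `1`, so summing over `a` removes the dependence on the hidden variable
in `Ω'`. -/
theorem sum_average (hh : IsConditionalDistribution μ h)
    (hf : IsConditionalDistribution (μ.prod ν) f) (o : O) :
    ∀ᵐ l ∂ν, ∑ a, average μ h f o a l = ∫ k, h o k ∂μ := by
  have h1 := Measure.ae_ae_of_ae_prod
    ((Measure.measurePreserving_swap (μ := ν) (ν := μ)).quasiMeasurePreserving.ae hf.2.2)
  have h2 : ∀ᵐ l ∂ν, ∀ a, Integrable (fun k => h o k * f a (k, l)) μ :=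
    ae_all_iff.2 fun a => (integrable_mul_fst hh hf o a).prod_left_ae
  filter_upwards [h1, h2] with l h1 h2
  simp only [average]
  rw [← integral_finsetSum _ fun a _ => h2 a]
  refine integral_congr_ae ?_
  filter_upwards [h1] with k hk
  rw [← Finset.mul_sum]
  exact (congrArg _ hk).trans (mul_one _)

end Averaging

variable {X A B Y : Type*} [Fintype X] [Fintype A] [Fintype B] [Fintype Y]
  {p : X → A → B → Y → ℝ}

namespace ClassicalModel

variable (M : ClassicalModel.{u} X A B Y)

/-- The response function of `B` with its hidden variables in the opposite order. -/
def fBswap (b : B) (q : M.sBY.carrier × M.sAB.carrier) : ℝ := M.fB b q.swap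

theorem isConditionalDistribution_fBswap :
    IsConditionalDistribution (M.sBY.dist.prod M.sAB.dist) M.fBswap :=
  M.hB.comp Measure.measurePreserving_swap.quasiMeasurePreserving

/-- Given the hidden variable of the middle source, the two sides of the network are independent. -/
theorem prob_eq_integral_average (x : X) (a : A) (b : B) (y : Y) :
    Integrable (fun l => average M.sXA.dist M.fX M.fA x a l *
      average M.sBY.dist M.fY M.fBswap y b l) M.sAB.dist ∧
    M.prob x a b y = ∫ l, average M.sXA.dist M.fX M.fA x a l *
      average M.sBY.dist M.fY M.fBswap y b l ∂M.sAB.dist := by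
  have hi : Integrable (fun l : M.sXA.carrier × M.sAB.carrier × M.sBY.carrier =>
      M.fX x l.1 * M.fA a (l.1, l.2.1) * M.fB b (l.2.1, l.2.2) * M.fY y l.2.2)
      (M.sXA.dist.prod (M.sAB.dist.prod M.sBY.dist)) := by
    refine (M.hY.comp (Measure.quasiMeasurePreserving_snd.comp
      Measure.quasiMeasurePreserving_snd)).integrable_mul y ?_
    refine (M.hB.comp Measure.quasiMeasurePreserving_snd).integrable_mul b ?_
    refine (M.hA.comp ?_).integrable_mul a
      ((M.hX.comp Measure.quasiMeasurePreserving_fst).integrable x)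
    exact ((MeasurePreserving.id _).prod measurePreserving_fst).quasiMeasurePreserving
  have h1 : ∀ q : M.sAB.carrier × M.sBY.carrier,
      ∫ k, M.fX x k * M.fA a (k, q.1) * M.fB b (q.1, q.2) * M.fY y q.2 ∂M.sXA.dist =
        average M.sXA.dist M.fX M.fA x a q.1 * (M.fY y q.2 * M.fBswap b (q.2, q.1)) := fun q => by
    simp only [mul_assoc (_ * _) _ _]
    rw [integral_mul_const, mul_comm (M.fB b _)]
    rfl
  have hi2 := hi.integral_prod_right
  simp only [h1] at hi2
  constructor
  · have h := hi2.integral_prod_left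
    simp only [integral_const_mul] at h
    exact h
  rw [prob, integral_prod_symm _ hi]
  simp only [h1]
  rw [integral_prod _ hi2]
  simp only [integral_const_mul]
  rfl

/-- If the `P₄` correlation is classical, then the hidden variable of the source in the middle is a
local hidden variable for the conditional distribution. -/
theorem isClassical_cond (hp : IsCorrelation p)
    (hx : ∀ x, 0 < margX p x) (hy : ∀ y, 0 < margY p y)
    (hM : ∀ x a b y, p x a b y = M.prob x a b y) : Bell.IsClassical.{u} (cond p) := by
  set E := average M.sXA.dist M.fX M.fA with hE
  set F := average M.sBY.dist M.fY M.fBswap with hF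
  have hEF : ∀ x a b y, p x a b y = ∫ l, E x a l * F y b l ∂M.sAB.dist := fun x a b y =>
    (hM x a b y).trans (M.prob_eq_integral_average x a b y).2
  have hB := M.isConditionalDistribution_fBswap
  have hi : ∀ x a b y, Integrable (fun l => E x a l * F y b l) M.sAB.dist := fun x a b y =>
    (M.prob_eq_integral_average x a b y).1
  set c : X → ℝ := fun x => ∫ k, M.fX x k ∂M.sXA.dist
  set d : Y → ℝ := fun y => ∫ k, M.fY y k ∂M.sBY.dist
  have hE1 : ∀ x, ∀ᵐ l ∂M.sAB.dist, ∑ a, E x a l = c x := sum_average M.hX M.hA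
  have hF1 : ∀ y, ∀ᵐ l ∂M.sAB.dist, ∑ b, F y b l = d y := sum_average M.hY hB
  have hcd : ∀ x y, margXY p x y = c x * d y := fun x y => by
    simp only [margXY, hEF]
    simp only [← integral_finsetSum _ fun b _ => hi x _ b y]
    rw [← integral_finsetSum _ fun a _ => integrable_finsetSum _ fun b _ => hi x a b y]
    have h : ∀ᵐ l ∂M.sAB.dist, ∑ a, ∑ b, E x a l * F y b l = c x * d y := by
      filter_upwards [hE1 x, hF1 y] with l h1 h2
      rw [← Finset.sum_mul_sum, h1, h2]
    rw [integral_congr_ae h]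
    simp
  have hcd' : ∀ x y, (margXY p x y : ℂ) = c x * d y := fun x y => by exact_mod_cast hcd x y
  have hc : ∀ x, c x = margX p x := fun x => by
    exact_mod_cast eq_margX_of_margXY_eq_mul hcd' (by exact_mod_cast M.hY.sum_integral) x
  have hd : ∀ y, d y = margY p y := fun y => by
    exact_mod_cast eq_margY_of_margXY_eq_mul hcd' (by exact_mod_cast M.hX.sum_integral) y
  refine ⟨M.sAB, fun x a l => (margX p x)⁻¹ * E x a l, fun y b l => (margY p y)⁻¹ * F y b l,
    fun x => ⟨fun a => ?_, fun a => ?_, ?_⟩, fun y => ⟨fun b => ?_, fun b => ?_, ?_⟩,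
    fun x y a b => ?_⟩
  · exact ((integrable_average M.hX M.hA x a).1.aemeasurable).const_mul _
  · filter_upwards [average_nonneg M.hX M.hA x a] with l hl
    exact mul_nonneg (inv_pos.2 (hx x)).le hl
  · filter_upwards [hE1 x] with l hl
    rw [← Finset.mul_sum, hl, hc, inv_mul_cancel₀ (hx x).ne']
  · exact ((integrable_average M.hY hB y b).1.aemeasurable).const_mul _
  · filter_upwards [average_nonneg M.hY hB y b] with l hl
    exact mul_nonneg (inv_pos.2 (hy y)).le hl
  · filter_upwards [hF1 y] with l hl
    rw [← Finset.mul_sum, hl, hd, inv_mul_cancel₀ (hy y).ne']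
  · simp only [mul_mul_mul_comm _ (E x a _)]
    rw [integral_const_mul, ← hEF, cond, hp.margXY_eq, div_eq_inv_mul, mul_inv]

end ClassicalModel

/-! ### From a local hidden variable to a classical network -/

variable (X) in
/-- Every distribution on `X` is that of a function of a hidden variable in any given universe. -/
theorem exists_hiddenVariable {q : X → ℝ} (hq : ∀ x, 0 ≤ q x) (h1 : ∑ x, q x = 1) :
    ∃ (s : HiddenVariable.{u}) (r : s.carrier → X), (∀ S, MeasurableSet (r ⁻¹' S)) ∧
      ∀ x, s.dist.real (r ⁻¹' {x}) = q x := by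
  let e : ULift.{u} (Fin (Fintype.card X)) ≃ X := Equiv.ulift.trans (Fintype.equivFin X).symm
  let P : PMF (ULift.{u} (Fin (Fintype.card X))) :=
    PMF.ofFintype (fun i => ENNReal.ofReal (q (e i))) (by
      rw [← ENNReal.ofReal_sum_of_nonneg fun i _ => hq _, e.sum_comp q, h1, ENNReal.ofReal_one])
  let _ : MeasurableSpace (ULift.{u} (Fin (Fintype.card X))) := ⊤
  refine ⟨⟨_, P.toMeasure⟩, e, fun _ => trivial, fun x => ?_⟩
  have h2 : e ⁻¹' {x} = {e.symm x} := by
    ext i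
    simp [Equiv.eq_symm_apply]
  have h3 : P.toMeasure {e.symm x} = P (e.symm x) :=
    PMF.toMeasure_apply_singleton P _ MeasurableSpace.measurableSet_top
  rw [h2, measureReal_def]
  change (P.toMeasure _).toReal = _
  rw [h3]
  simp [P, hq]

theorem average_label {X A Ω Ω' : Type*} [MeasurableSpace Ω] {μ : Measure Ω} {r : Ω → X}
    {E : X → A → Ω' → ℝ} (hr : ∀ S, MeasurableSet (r ⁻¹' S)) (x : X) (a : A) (l : Ω') :
    average μ (fun x => (r ⁻¹' {x}).indicator (1 : Ω → ℝ)) (fun a q => E (r q.1) a q.2) x a l =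
      μ.real (r ⁻¹' {x}) * E x a l := by
  classical
  have h : ∀ k, (r ⁻¹' {x}).indicator (1 : Ω → ℝ) k * E (r k) a l =
      (r ⁻¹' {x}).indicator (1 : Ω → ℝ) k * E x a l := fun k => by
    by_cases hk : r k = x <;> simp [hk]
  simp only [average, h]
  rw [integral_mul_const, integral_indicator_one (hr _)]

section Labelled

variable {Ω Ω' : Type*} [MeasurableSpace Ω] [MeasurableSpace Ω'] {μ : Measure Ω} {ν : Measure Ω'}
  {r : Ω → X} {E : X → A → Ω' → ℝ}

theorem isConditionalDistribution_indicator (hr : ∀ S, MeasurableSet (r ⁻¹' S)) :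
    IsConditionalDistribution μ fun x => (r ⁻¹' {x}).indicator (1 : Ω → ℝ) := by
  classical
  refine ⟨fun x => (measurable_one.indicator (hr _)).aemeasurable, fun x => ae_of_all _ fun k =>
    Set.indicator_nonneg (fun _ _ => zero_le_one) k, ae_of_all _ fun k => ?_⟩
  simp [Set.indicator_apply]

/-- Using a copy `r` of `x` as the setting turns the response functions `E x` into a single one. -/
theorem isConditionalDistribution_label [SFinite ν] (hr : ∀ S, MeasurableSet (r ⁻¹' S))
    (hE : ∀ x, IsConditionalDistribution ν (E x)) :
    IsConditionalDistribution (μ.prod ν) fun a q => E (r q.1) a q.2 := by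
  classical
  have hE' := fun x => (hE x).comp (Measure.quasiMeasurePreserving_snd (μ := μ) (ν := ν))
  refine ⟨fun a => ?_, fun a => ?_, ?_⟩
  · have h : (fun q : Ω × Ω' => E (r q.1) a q.2) = fun q =>
        ∑ x, (r ⁻¹' {x}).indicator (1 : Ω → ℝ) q.1 * E x a q.2 := by
      ext q
      simp [Set.indicator_apply]
    simp only [h]
    exact Finset.aemeasurable_fun_sum _ fun x _ =>
      ((measurable_one.indicator (hr _)).comp measurable_fst).aemeasurable.mul ((hE' x).1 a)
  · filter_upwards [ae_all_iff.2 fun x => (hE' x).2.1 a] with q hq using hq _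
  · filter_upwards [ae_all_iff.2 fun x => (hE' x).2.2] with q hq using hq _

end Labelled

/-- The outer sources distribute copies of `x` and `y`, which `A` and `B` use as settings. -/
theorem isClassical_of_cond (hp : IsCorrelation p)
    (hx : ∀ x, 0 < margX p x) (hy : ∀ y, 0 < margY p y)
    (h : Bell.IsClassical.{u} (cond p)) : IsClassical.{u} p := by
  obtain ⟨s, f, g, hf, hg, hfg⟩ := h
  obtain ⟨sX, r, hr, hrx⟩ := exists_hiddenVariable.{u} X (fun x => (hx x).le) hp.sum_margX
  obtain ⟨sY, t, ht, hty⟩ := exists_hiddenVariable.{u} Y (fun y => (hy y).le) hp.sum_margY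
  let M : ClassicalModel.{u} X A B Y :=
    { sXA := sX, sAB := s, sBY := sY
      fX := fun x => (r ⁻¹' {x}).indicator 1
      fA := fun a q => f (r q.1) a q.2
      fB := fun b q => g (t q.2) b q.1
      fY := fun y => (t ⁻¹' {y}).indicator 1
      hX := isConditionalDistribution_indicator hr
      hA := isConditionalDistribution_label hr hf
      hB := (isConditionalDistribution_label ht hg).comp
        Measure.measurePreserving_swap.quasiMeasurePreserving
      hY := isConditionalDistribution_indicator ht }
  refine ⟨M, fun x a b y => ?_⟩
  have hl : average M.sXA.dist M.fX M.fA x a = fun l => margX p x * f x a l := by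
    ext l
    rw [← hrx]
    exact average_label hr x a l
  have hr : average M.sBY.dist M.fY M.fBswap y b = fun l => margY p y * g y b l := by
    ext l
    rw [← hty]
    exact average_label ht y b l
  rw [(M.prob_eq_integral_average x a b y).2, hl, hr]
  simp only [mul_mul_mul_comm _ (f x a _)]
  rw [integral_const_mul]
  change _ = _ * ∫ l, f x a l * g y b l ∂s.dist
  rw [← hfg, cond, hp.margXY_eq, mul_div_cancel₀ _ (mul_pos (hx x) (hy y)).ne']

end P4

end

theorem theorem2p4 {X A B Y : Type*} [Fintype X] [Fintype A] [Fintype B] [Fintype Y]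
    (p : X → A → B → Y → ℝ) (hp : P4.IsCorrelation p)
    (hx : ∀ x, 0 < P4.margX p x) (hy : ∀ y, 0 < P4.margY p y) :
    (P4.IsClassical.{u} p ↔ Bell.IsClassical.{u} (P4.cond p)) ∧
      (P4.IsQuantum.{u} p ↔ Bell.IsQuantum.{u} (P4.cond p)) :=
  ⟨⟨fun ⟨M, hM⟩ => M.isClassical_cond hp hx hy hM, P4.isClassical_of_cond hp hx hy⟩,
    ⟨fun ⟨M, hM⟩ => M.isQuantum_cond hp hx hy hM, P4.isQuantum_of_cond hp hx hy⟩⟩
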